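/- Let $\sigma_1=\begin{pmatrix}0&1\\1&0\end{pmatrix}$, $\sigma_2=\begin{pmatrix}0&-i\\i&0\end{pmatrix}$, $\sigma_3=\begin{pmatrix}1&0\\0&-1\end{pmatrix}$ be the Pauli matrices, and for $x=(x_1,x_2)\in\mathbb{S}^1\subset\mathbb{R}^2$ put $\sigma\cdot x=x_1\sigma_1+x_2\sigma_2$. For $\delta\ge 0$ and $x\in\mathbb{S}^1$ consider in $L^2((-1,1),\mathbb{C}^2)$ the operator \[ \mathcal{T}_x(\delta)=-i(\sigma\cdot x)\frac{d}{dt}+\delta\sigma_3,\qquad \mathrm{dom}(\mathcal{T}_x(\delta))=\{f=(f_1,f_2)^\top\in H^1((-1,1),\mathbb{C}^2): f_2(\pm1)=\pm i(x_1+ix_2)f_1(\pm1)\}. \] Then the following holds. (i) For all $\delta\ge0$ and $x\in\mathbb{S}^1$ the operator $\mathcal{T}_x(\delta)$ is self-adjoint with compact resolvent, its spectrum is symmetric with respect to $0$ and does not depend on $x$. It has infinitely many positive eigenvalues; they can be listed in non-decreasing order with multiplicities as $\lambda_1(\delta)\le\lambda_2(\delta)\le\cdots$, the same list for all $x$, and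 for every $j\ge1$ \[ (2j-1)^2\frac{\pi^2}{16}\le\lambda_j(\delta)^2-\delta^2\le j^2\frac{\pi^2}{4}. \] If $\phi$ is a normalized eigenfunction of $\mathcal{T}_x(\delta)$ for $\lambda_j(\delta)$, then $\sigma_1\overline{\phi}$ is a normalized eigenfunction for $-\lambda_j(\delta)$. (ii) For every fixed $j\ge1$, as $\delta\to0$ with $\delta\ge0$, \[ \lambda_j(\delta)=\frac{(2j-1)\pi}{4}+\frac{2}{(2j-1)\pi}\delta+\left(\frac{-16}{(2j-1)^3\pi^3}+\frac{2}{(2j-1)\pi}\right)\delta^2+\mathcal{O}(\delta^3). \] (iii) For $j\ge1$ and $x\in\mathbb{S}^1$ let \[ \phi_j^+(t)=\tfrac12\cos\Big(\tfrac{(2j-1)\pi}{4}(t+1)\Big)\begin{pmatrix}1\\-i(x_1+ix_2)\end{pmatrix}+\tfrac12\sin\Big(\tfrac{(2j-1)\pi}{4}(t+1)\Big)\begin{pmatrix}1\\i(x_1+ix_2)\end{pmatrix},\qquad \phi_j^-=\sigma_1\overline{\phi_j^+}. \] For every $j\ge1$ there are $C,\delta_0>0$ such that for all $\delta\in[0,\delta_0]$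 and $x\in\mathbb{S}^1$ there is a normalized eigenfunction $\phi_{j,\delta}^+$ of $\mathcal{T}_x(\delta)$ for $\lambda_j(\delta)$ such that, with $\phi_{j,\delta}^-=\sigma_1\overline{\phi_{j,\delta}^+}$, \[ \|\phi_{j,\delta}^\pm-\phi_j^\pm\|_{L^\infty((-1,1),\mathbb{C}^2)}\le C\delta ; \] moreover, for every normalized eigenfunction $\psi$ for $\pm\lambda_j(\delta)$ there is $c\in\mathbb{C}$ with $|c|=1$ and $\|c\psi-\phi_j^\pm\|_{L^\infty}\le C\delta$. (iv) For all $\delta\ge0$, $x\in\mathbb{S}^1$ and $f\in\mathrm{dom}(\mathcal{T}_x(\delta))$, \[ \|\mathcal{T}_x(\delta)f\|_{L^2}^2=\|f'\|_{L^2}^2+\delta^2\|f\|_{L^2}^2+\delta\big(|f(1)|^2+|f(-1)|^2\big). \] -/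

import Mathlib

open MeasureTheory
open scoped ContDiff Matrix

namespace TransverseDirac

noncomputable section

/-! ### Unbounded operators: resolvent, spectrum, eigenvalues -/

section Operators

variable {H : Type} [NormedAddCommGroup H] [NormedSpace ℂ H]

/-- `R` is a bounded everywhere defined two-sided inverse of `T - z : dom T → H`. -/
def IsResolvent (T : H →ₗ.[ℂ] H) (z : ℂ) (R : H →L[ℂ] H) : Prop :=
  (∀ y : H, ∃ h : R y ∈ T.domain, T ⟨R y, h⟩ - z • R y = y) ∧
  (∀ f : T.domain, R (T f - z • (f : H)) = f)

/-- The resolvent set of an unbounded operator. -/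
def resolventSet (T : H →ₗ.[ℂ] H) : Set ℂ := {z | ∃ R : H →L[ℂ] H, IsResolvent T z R}

/-- The spectrum of an unbounded operator. -/
def spectrum (T : H →ₗ.[ℂ] H) : Set ℂ := (resolventSet T)ᶜ

/-- The resolvent set is non-empty and all resolvents are compact operators. -/
def HasCompactResolvent (T : H →ₗ.[ℂ] H) : Prop :=
  (resolventSet T).Nonempty ∧
    ∀ (z : ℂ) (R : H →L[ℂ] H), IsResolvent T z R → IsCompactOperator R

/-- The space `{f ∈ dom T : T f = z f}`. -/
def eigenspace (T : H →ₗ.[ℂ] H) (z : ℂ) : Submodule ℂ H where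
  carrier := {f | ∃ h : f ∈ T.domain, T ⟨f, h⟩ = z • f}
  zero_mem' := ⟨T.domain.zero_mem, by
    rw [smul_zero]; exact T.map_zero⟩
  add_mem' := by
    rintro f g ⟨hf, ef⟩ ⟨hg, eg⟩
    refine ⟨T.domain.add_mem hf hg, ?_⟩
    have := T.map_add ⟨f, hf⟩ ⟨g, hg⟩
    rw [ef, eg, ← smul_add] at this
    exact this
  smul_mem' := by
    rintro c f ⟨hf, ef⟩
    refine ⟨T.domain.smul_mem c hf, ?_⟩
    have := T.map_smul c ⟨f, hf⟩
    rw [ef, smul_comm] at this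
    exact this

/-- `f` is a normalized eigenvector of `T` for the eigenvalue `z`. -/
def IsNormalizedEigenvector (T : H →ₗ.[ℂ] H) (z : ℂ) (f : H) : Prop :=
  f ∈ eigenspace T z ∧ ‖f‖ = 1

/-- `lam 1 ≤ lam 2 ≤ ...` is the sequence of all positive eigenvalues of `T` in non-decreasing
order, each one repeated according to its multiplicity; that is, `lam j` is the `j`-th positive
eigenvalue of `T` for every `j ≥ 1` (the value `lam 0` is not used). -/
def IsPosEigenvalueSeq (T : H →ₗ.[ℂ] H) (lam : ℕ → ℝ) : Prop :=
  MonotoneOn lam (Set.Ici 1) ∧ (∀ j, 1 ≤ j → 0 < lam j) ∧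
    ∀ μ : ℝ, 0 < μ →
      Module.rank ℂ (eigenspace T (μ : ℂ)) = Cardinal.mk {j : ℕ // 1 ≤ j ∧ lam j = μ}

end Operators

/-! ### The spaces `L²((-1,1),ℂ²)` and `H¹((-1,1),ℂ²)` -/

/-- `ℂ²` with its Hermitian norm. -/
abbrev C2 := EuclideanSpace ℂ (Fin 2)

/-- Lebesgue measure on `(-1,1)`. -/
abbrev vol : Measure ℝ := volume.restrict (Set.Ioo (-1 : ℝ) 1)

/-- The Hilbert space `L²((-1,1),ℂ²)`. -/
abbrev L2 := Lp C2 2 vol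

/-- `g` is the weak derivative of `f` on `(-1,1)`. -/
def HasWeakDeriv (f g : L2) : Prop :=
  ∀ φ : ℝ → ℝ, ContDiff ℝ ∞ φ → HasCompactSupport φ → tsupport φ ⊆ Set.Ioo (-1 : ℝ) 1 →
    ∫ t, deriv φ t • f t ∂vol = - ∫ t, φ t • g t ∂vol

theorem integrable_smul {φ : ℝ → ℝ} (hφ : Continuous φ) (hs : HasCompactSupport φ) (f : L2) :
    Integrable (fun t => φ t • f t) vol := by
  obtain ⟨C, hC⟩ := hs.exists_bound_of_continuous hφ
  have hf : Integrable (fun t => f t) vol := (Lp.memLp f).integrable (by norm_num)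
  exact hf.bdd_smul C hφ.aestronglyMeasurable (Filter.Eventually.of_forall hC)

theorem integral_smul_add {φ : ℝ → ℝ} (hφ : Continuous φ) (hs : HasCompactSupport φ) (f g : L2) :
    ∫ t, φ t • (f + g : L2) t ∂vol = (∫ t, φ t • f t ∂vol) + ∫ t, φ t • g t ∂vol := by
  rw [← integral_add (integrable_smul hφ hs f) (integrable_smul hφ hs g)]
  refine integral_congr_ae ?_
  filter_upwards [Lp.coeFn_add f g] with t ht
  rw [ht, Pi.add_apply, smul_add]

theorem integral_smul_smul (φ : ℝ → ℝ) (c : ℂ) (f : L2) :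
    ∫ t, φ t • (c • f : L2) t ∂vol = c • ∫ t, φ t • f t ∂vol := by
  rw [← integral_smul]
  refine integral_congr_ae ?_
  filter_upwards [Lp.coeFn_smul c f] with t ht
  rw [ht, Pi.smul_apply, smul_comm]

theorem HasWeakDeriv.add {f g f' g' : L2} (hf : HasWeakDeriv f f') (hg : HasWeakDeriv g g') :
    HasWeakDeriv (f + g) (f' + g') := by
  intro φ h1 h2 h3
  rw [integral_smul_add (h1.continuous_deriv (by simp)) h2.deriv,
    integral_smul_add h1.continuous h2, hf φ h1 h2 h3, hg φ h1 h2 h3, neg_add]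

theorem HasWeakDeriv.smul {f f' : L2} (c : ℂ) (hf : HasWeakDeriv f f') :
    HasWeakDeriv (c • f) (c • f') := by
  intro φ h1 h2 h3
  rw [integral_smul_smul, integral_smul_smul, hf φ h1 h2 h3, smul_neg]

theorem HasWeakDeriv.zero : HasWeakDeriv 0 0 := by
  have h : HasWeakDeriv ((0 : ℂ) • (0 : L2)) ((0 : ℂ) • (0 : L2)) := by
    intro φ _ _ _
    rw [integral_smul_smul, integral_smul_smul, zero_smul, zero_smul, neg_zero]
  simpa using h

theorem HasWeakDeriv.unique {f g g' : L2} (h : HasWeakDeriv f g) (h' : HasWeakDeriv f g') :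
    g = g' := by
  have hd : HasWeakDeriv (f + (-1 : ℂ) • f) (g + (-1 : ℂ) • g') := h.add (h'.smul (-1))
  have hf : f + (-1 : ℂ) • f = 0 := by simp
  rw [hf] at hd
  have hint : Integrable (fun t => (g + (-1 : ℂ) • g' : L2) t) vol :=
    (Lp.memLp _).integrable (by norm_num)
  have key := (isOpen_Ioo (a := (-1 : ℝ)) (b := 1)).ae_eq_zero_of_integral_contDiff_smul_eq_zero
    (μ := vol) (f := fun t => (g + (-1 : ℂ) • g' : L2) t)
    (hint.locallyIntegrable.locallyIntegrableOn _) (by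
      intro φ h1 h2 h3
      have e := hd φ h1 h2 h3
      have z : ∫ t, deriv φ t • (0 : L2) t ∂vol = 0 := by
        have := integral_smul_smul (deriv φ) 0 0
        simpa using this
      rw [z] at e
      exact neg_eq_zero.mp e.symm)
  have hz : g + (-1 : ℂ) • g' = 0 := by
    rw [Lp.eq_zero_iff_ae_eq_zero]
    filter_upwards [key, ae_restrict_mem measurableSet_Ioo] with t ht hmem
    exact ht hmem
  have : g - g' = 0 := by simpa [sub_eq_add_neg] using hz
  exact sub_eq_zero.mp this

/-- The Sobolev space `H¹((-1,1),ℂ²)`, as a subspace of `L²((-1,1),ℂ²)`. -/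
def H1 : Submodule ℂ L2 where
  carrier := {f | ∃ g, HasWeakDeriv f g}
  zero_mem' := ⟨0, HasWeakDeriv.zero⟩
  add_mem' := fun ⟨g, hg⟩ ⟨g', hg'⟩ => ⟨g + g', hg.add hg'⟩
  smul_mem' := fun c _ ⟨g, hg⟩ => ⟨c • g, hg.smul c⟩

/-- The weak derivative `f ↦ f'` on `H¹((-1,1),ℂ²)`. -/
def weakDeriv : H1 →ₗ[ℂ] L2 where
  toFun f := Classical.choose f.2
  map_add' f g := (Classical.choose_spec (f + g).2).unique
    ((Classical.choose_spec f.2).add (Classical.choose_spec g.2))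
  map_smul' c f := (Classical.choose_spec (c • f).2).unique
    ((Classical.choose_spec f.2).smul c)

theorem hasWeakDeriv_weakDeriv (f : H1) : HasWeakDeriv f (weakDeriv f) :=
  Classical.choose_spec f.2

/-- `u` is a representative of `f` that is continuous on `[-1,1]`. Every element of
`H¹((-1,1),ℂ²)` has one, unique on `[-1,1]`; its values at `±1` are the boundary values `f(±1)`. -/
def IsContRep (f : L2) (u : ℝ → C2) : Prop :=
  ContinuousOn u (Set.Icc (-1) 1) ∧ f =ᵐ[vol] u

/-! ### The transverse operator -/

/-- The Pauli matrix `σ₁`. -/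
def pauli1 : Matrix (Fin 2) (Fin 2) ℂ := !![0, 1; 1, 0]

/-- The Pauli matrix `σ₂`. -/
def pauli2 : Matrix (Fin 2) (Fin 2) ℂ := !![0, -Complex.I; Complex.I, 0]

/-- The Pauli matrix `σ₃`. -/
def pauli3 : Matrix (Fin 2) (Fin 2) ℂ := !![1, 0; 0, -1]

/-- `σ · x = x₁ σ₁ + x₂ σ₂`. -/
def pauliDot (x : EuclideanSpace ℝ (Fin 2)) : Matrix (Fin 2) (Fin 2) ℂ :=
  (x 0 : ℂ) • pauli1 + (x 1 : ℂ) • pauli2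

/-- The complex number `x₁ + i x₂`. -/
def toC (x : EuclideanSpace ℝ (Fin 2)) : ℂ := (x 0 : ℂ) + Complex.I * (x 1 : ℂ)

/-- Pointwise multiplication by a constant matrix, on `L²((-1,1),ℂ²)`. -/
def matMul (A : Matrix (Fin 2) (Fin 2) ℂ) : L2 →L[ℂ] L2 :=
  (Matrix.toEuclideanCLM (𝕜 := ℂ) A).compLpL 2 vol

/-- The boundary conditions `u₂(±1) = ± i (x₁ + i x₂) u₁(±1)`. -/
def BoundaryCond (x : EuclideanSpace ℝ (Fin 2)) (u : ℝ → C2) : Prop :=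
  u 1 1 = Complex.I * toC x * u 1 0 ∧ u (-1) 1 = -(Complex.I * toC x * u (-1) 0)

/-- The domain of the transverse operator: the elements of `H¹((-1,1),ℂ²)` whose boundary values
satisfy the boundary conditions. -/
def transverseDomain (x : EuclideanSpace ℝ (Fin 2)) : Submodule ℂ L2 where
  carrier := {f | f ∈ H1 ∧ ∃ u, IsContRep f u ∧ BoundaryCond x u}
  zero_mem' := ⟨H1.zero_mem, 0, ⟨continuousOn_const, Lp.coeFn_zero _ _ _⟩, by
    simp [BoundaryCond]⟩
  add_mem' := by
    rintro f g ⟨hf, u, ⟨cu, eu⟩, bu⟩ ⟨hg, v, ⟨cv, ev⟩, bv⟩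
    refine ⟨H1.add_mem hf hg, u + v, ⟨cu.add cv, ?_⟩, ?_, ?_⟩
    · exact (Lp.coeFn_add f g).trans (eu.add ev)
    · simp only [Pi.add_apply, PiLp.add_apply, bu.1, bv.1]; ring
    · simp only [Pi.add_apply, PiLp.add_apply, bu.2, bv.2]; ring
  smul_mem' := by
    rintro c f ⟨hf, u, ⟨cu, eu⟩, bu⟩
    refine ⟨H1.smul_mem c hf, c • u, ⟨cu.const_smul c, ?_⟩, ?_, ?_⟩
    · exact (Lp.coeFn_smul c f).trans (eu.const_smul c)
    · simp only [Pi.smul_apply, PiLp.smul_apply, smul_eq_mul, bu.1]; ring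
    · simp only [Pi.smul_apply, PiLp.smul_apply, smul_eq_mul, bu.2]; ring

theorem transverseDomain_le (x : EuclideanSpace ℝ (Fin 2)) : transverseDomain x ≤ H1 :=
  fun _ h => h.1

/-- The weak derivative of an element of the domain of the transverse operator. -/
def domDeriv (x : EuclideanSpace ℝ (Fin 2)) : transverseDomain x →ₗ[ℂ] L2 :=
  weakDeriv ∘ₗ Submodule.inclusion (transverseDomain_le x)

/-- The transverse operator `f ↦ -i (σ · x) f' + δ σ₃ f`. -/
def transverseOp (x : EuclideanSpace ℝ (Fin 2)) (δ : ℝ) : L2 →ₗ.[ℂ] L2 where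
  domain := transverseDomain x
  toFun := (-Complex.I) • ((matMul (pauliDot x)).toLinearMap ∘ₗ domDeriv x) +
    (δ : ℂ) • ((matMul pauli3).toLinearMap ∘ₗ (transverseDomain x).subtype)

/-! ### Charge conjugation and the limit profiles -/

/-- Componentwise complex conjugation on `ℂ²`. -/
def conjC2 : C2 →SL[starRingEnd ℂ] C2 where
  toFun v := WithLp.toLp 2 (fun i => starRingEnd ℂ (v i))
  map_add' v w := by ext i; simp
  map_smul' c v := by ext i; simp
  cont := by fun_prop

/-- The charge conjugation `v ↦ σ₁ v̄` on `ℂ²`. -/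
def chargeConjC2 : C2 →SL[starRingEnd ℂ] C2 :=
  (Matrix.toEuclideanCLM (𝕜 := ℂ) pauli1).comp conjC2

/-- The charge conjugation `f ↦ σ₁ f̄` on `L²((-1,1),ℂ²)`. -/
def chargeConj : L2 →SL[starRingEnd ℂ] L2 := chargeConjC2.compLpL 2 vol

/-- The profile `φ_j⁺`. -/
def profilePlus (x : EuclideanSpace ℝ (Fin 2)) (j : ℕ) (t : ℝ) : C2 :=
  ((1 / 2 * Real.cos ((2 * j - 1) * Real.pi / 4 * (t + 1)) : ℝ) : ℂ) •
      !₂[(1 : ℂ), -(Complex.I * toC x)] +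
    ((1 / 2 * Real.sin ((2 * j - 1) * Real.pi / 4 * (t + 1)) : ℝ) : ℂ) •
      !₂[(1 : ℂ), Complex.I * toC x]

/-- The profile `φ_j⁻ = σ₁ conj(φ_j⁺)`. -/
def profileMinus (x : EuclideanSpace ℝ (Fin 2)) (j : ℕ) (t : ℝ) : C2 :=
  chargeConjC2 (profilePlus x j t)

/-- The distance in `L^∞((-1,1),ℂ²)`. -/
def supDist (f g : ℝ → C2) : ENNReal := eLpNorm (fun t => f t - g t) ⊤ vol

end

end TransverseDirac

/-!
The boundary conditions say that `f(-1)` and `f(1)` are eigenvectors of the Hermitian involution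
`J = i (σ · x) σ₃` for opposite eigenvalues, and `J` anticommutes with `σ · x` and with `σ₃`.
Integration by parts therefore shows that the operator is symmetric and gives the identity for
`‖T f‖²`, which bounds `T` from below. At `δ = 0` the operator is inverted by taking primitives;
this compact inverse is a parametrix for every `δ`, and the Fredholm alternative together with
injectivity provides a compact inverse for all `δ ≥ 0`. A symmetric surjective operator is
self-adjoint. Conjugation by `J` changes the sign of the operator, conjugation by a diagonal unitary
matrix changes `x`, and `f ↦ σ₁ f̄` interchanges the eigenspaces of `λ` and `-λ`.

The eigenvalue equation is a linear system `f' = M f` with constant coefficients, so eigenspaces are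
at most one-dimensional. For `λ² = k² + δ²` with `k > 0`, the solution with the right value at `-1`
satisfies the condition at `1` iff `k cos 2k + δ sin 2k = 0`. The phase `2k - arctan (δ / k)` is
increasing in `k`, and the solutions are the points where it takes the values `(2j - 1)π/2`; this
yields one simple eigenvalue for each `j`, the bounds, and, by iterating the fixed point equation,
the expansion as `δ → 0`.
-/

namespace TransverseDirac

noncomputable section

/-! ### Primitives and integration by parts -/

section Primitive

variable {E F G : Type*} [NormedAddCommGroup E] [NormedSpace ℝ E]
  [NormedAddCommGroup F] [NormedSpace ℝ F] [NormedAddCommGroup G] [NormedSpace ℝ G]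
  {μ : Measure ℝ}

/-- The primitive `t ↦ ∫_{(-∞, t]} f dμ`. For `μ = vol` it is the primitive on `(-1,1)` that
vanishes at `-1`. -/
def primitive (μ : Measure ℝ) (f : ℝ → E) (t : ℝ) : E := ∫ s in Set.Iic t, f s ∂μ

theorem primitive_sub_primitive {f : ℝ → E} (hf : Integrable f μ) {s t : ℝ} (h : s ≤ t) :
    primitive μ f t - primitive μ f s = ∫ r in Set.Ioc s t, f r ∂μ := by
  rw [← intervalIntegral.integral_of_le h]
  exact intervalIntegral.integral_Iic_sub_Iic hf.integrableOn hf.integrableOn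

theorem continuous_primitive [NullSingletonClass μ] {f : ℝ → E} (hf : Integrable f μ) :
    Continuous (primitive μ f) := by
  have h : primitive μ f = fun t => primitive μ f 0 + ∫ s in (0 : ℝ)..t, f s ∂μ := by
    funext t
    rw [← intervalIntegral.integral_Iic_sub_Iic hf.integrableOn hf.integrableOn]
    simp [primitive]
  rw [h]
  exact continuous_const.add
    (intervalIntegral.continuous_primitive (fun a b => hf.intervalIntegrable) 0)

theorem norm_primitive_le_integral_norm {f : ℝ → E} (hf : Integrable f μ) (t : ℝ) :
    ‖primitive μ f t‖ ≤ ∫ s, ‖f s‖ ∂μ :=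
  (norm_integral_le_integral_norm f).trans
    (setIntegral_le_integral hf.norm (Filter.Eventually.of_forall fun _ => norm_nonneg _))

theorem integrable_bilin_primitive [NullSingletonClass μ] (L : E →L[ℝ] F →L[ℝ] G)
    {f : ℝ → E} {g : ℝ → F} (hf : Integrable f μ) (hg : Integrable g μ) :
    Integrable (fun t => L (f t) (primitive μ g t)) μ := by
  refine Integrable.mono' (hf.norm.const_mul (‖L‖ * ∫ s, ‖g s‖ ∂μ))
    (L.aestronglyMeasurable_comp₂ hf.1 (continuous_primitive hg).aestronglyMeasurable)
    (Filter.Eventually.of_forall fun t => ?_)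
  calc ‖L (f t) (primitive μ g t)‖ ≤ ‖L‖ * ‖f t‖ * ‖primitive μ g t‖ := L.le_opNorm₂ _ _
    _ ≤ ‖L‖ * ‖f t‖ * ∫ s, ‖g s‖ ∂μ := by gcongr; exact norm_primitive_le_integral_norm hg t
    _ = ‖L‖ * (∫ s, ‖g s‖ ∂μ) * ‖f t‖ := by ring

theorem integral_bilin_primitive_eq_setIntegral_prod [SFinite μ] [CompleteSpace E]
    [CompleteSpace G] (L : E →L[ℝ] F →L[ℝ] G) {f : ℝ → E} {g : ℝ → F} (hf : Integrable f μ)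
    (hI : Integrable (fun p : ℝ × ℝ => L (f p.1) (g p.2)) (μ.prod μ)) :
    ∫ t, L (primitive μ f t) (g t) ∂μ =
      ∫ p in {p : ℝ × ℝ | p.1 ≤ p.2}, L (f p.1) (g p.2) ∂(μ.prod μ) := by
  have hD : MeasurableSet {p : ℝ × ℝ | p.1 ≤ p.2} := measurableSet_le measurable_fst measurable_snd
  rw [← integral_indicator hD, integral_prod_symm _ (hI.indicator hD)]
  refine integral_congr_ae (Filter.Eventually.of_forall fun t => ?_)
  calc L (primitive μ f t) (g t) = ∫ s in Set.Iic t, L.flip (g t) (f s) ∂μ :=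
        (ContinuousLinearMap.integral_comp_comm (L.flip (g t)) hf.integrableOn).symm
    _ = ∫ s, (Set.Iic t).indicator (fun s => L (f s) (g t)) s ∂μ :=
        (integral_indicator measurableSet_Iic).symm

/-- Fubini's theorem on the two triangles cut out by the diagonal, which is a null set. -/
theorem integral_bilin_primitive [SFinite μ] [NullSingletonClass μ] [CompleteSpace E]
    [CompleteSpace F] [CompleteSpace G] (L : E →L[ℝ] F →L[ℝ] G) {f : ℝ → E} {g : ℝ → F}
    (hf : Integrable f μ) (hg : Integrable g μ) :
    (∫ t, L (f t) (primitive μ g t) ∂μ) + ∫ t, L (primitive μ f t) (g t) ∂μ =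
      L (∫ t, f t ∂μ) (∫ t, g t ∂μ) := by
  have hI : Integrable (fun p : ℝ × ℝ => L (f p.1) (g p.2)) (μ.prod μ) :=
    Integrable.op_fst_snd (op := fun a b => L a b) (by fun_prop)
      ⟨‖L‖, fun a b => L.le_opNorm₂ a b⟩ hf hg
  have inner_integral (t : ℝ) (s : Set ℝ) :
      ∫ r in s, L (f t) (g r) ∂μ = L (f t) (∫ r in s, g r ∂μ) :=
    ContinuousLinearMap.integral_comp_comm _ hg.integrableOn
  have upper : ∫ t, L (f t) (primitive μ g t) ∂μ =
      ∫ p in {p : ℝ × ℝ | p.1 ≤ p.2}ᶜ, L (f p.1) (g p.2) ∂(μ.prod μ) := by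
    have hD : MeasurableSet {p : ℝ × ℝ | p.1 ≤ p.2}ᶜ :=
      (measurableSet_le measurable_fst measurable_snd).compl
    rw [← integral_indicator hD, integral_prod _ (hI.indicator hD)]
    refine integral_congr_ae (Filter.Eventually.of_forall fun t => ?_)
    calc L (f t) (primitive μ g t) = ∫ s in Set.Iio t, L (f t) (g s) ∂μ := by
          rw [inner_integral, primitive, integral_Iic_eq_integral_Iio]
      _ = ∫ s, (Set.Iio t).indicator (fun s => L (f t) (g s)) s ∂μ :=
          (integral_indicator measurableSet_Iio).symm
      _ = _ := by
          congr 1 with s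
          simp only [Set.indicator_apply, Set.mem_compl_iff, Set.mem_ofPred_eq, not_le, Set.mem_Iio]
  rw [upper, integral_bilin_primitive_eq_setIntegral_prod L hf hI, add_comm,
    integral_add_compl (measurableSet_le measurable_fst measurable_snd) hI, integral_prod _ hI]
  have slice (t : ℝ) : ∫ r, L (f t) (g r) ∂μ = L.flip (∫ r, g r ∂μ) (f t) := by
    simpa using inner_integral t Set.univ
  simp only [slice]
  exact ContinuousLinearMap.integral_comp_comm _ hf

theorem integral_bilin_add_primitive [SFinite μ] [NullSingletonClass μ] [CompleteSpace E]
    [CompleteSpace F] [CompleteSpace G] (L : E →L[ℝ] F →L[ℝ] G) {f : ℝ → E} {g : ℝ → F}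
    (hf : Integrable f μ) (hg : Integrable g μ) (a : E) (b : F) :
    (∫ t, L (f t) (b + primitive μ g t) ∂μ) + ∫ t, L (a + primitive μ f t) (g t) ∂μ =
      L (a + ∫ t, f t ∂μ) (b + ∫ t, g t ∂μ) - L a b := by
  have hfb : Integrable (fun t => L (f t) b) μ := (L.flip b).integrable_comp hf
  have hag : Integrable (fun t => L a (g t)) μ := (L a).integrable_comp hg
  have hfG : Integrable (fun t => L (f t) (primitive μ g t)) μ := integrable_bilin_primitive L hf hg
  have hFg : Integrable (fun t => L (primitive μ f t) (g t)) μ :=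
    integrable_bilin_primitive L.flip hg hf
  have left : ∫ t, L (f t) (b + primitive μ g t) ∂μ =
      L (∫ t, f t ∂μ) b + ∫ t, L (f t) (primitive μ g t) ∂μ := by
    simp only [map_add]
    rw [integral_add hfb hfG]
    exact congrArg (· + _) ((L.flip b).integral_comp_comm hf)
  have right : ∫ t, L (a + primitive μ f t) (g t) ∂μ =
      L a (∫ t, g t ∂μ) + ∫ t, L (primitive μ f t) (g t) ∂μ := by
    simp only [map_add, add_apply]
    rw [integral_add hag hFg, (L a).integral_comp_comm hg]
  rw [left, right]
  simp only [map_add, add_apply, ← integral_bilin_primitive L hf hg]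
  abel

theorem primitive_vol_eq_intervalIntegral (f : ℝ → E) {t : ℝ} (ht : t ∈ Set.Icc (-1 : ℝ) 1) :
    primitive vol f t = ∫ s in (-1)..t, f s := by
  rw [primitive, vol, restrict_Ioo_eq_restrict_Ioc, Measure.restrict_restrict measurableSet_Iic,
    intervalIntegral.integral_of_le ht.1, Set.inter_comm, Set.Ioc_inter_Iic, min_eq_right ht.2]

theorem primitive_vol_neg_one (f : ℝ → E) : primitive vol f (-1) = 0 := by
  rw [primitive_vol_eq_intervalIntegral f (by simp), intervalIntegral.integral_same]

theorem primitive_vol_one (f : ℝ → E) : primitive vol f 1 = ∫ s, f s ∂vol := by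
  rw [primitive_vol_eq_intervalIntegral f (by simp), intervalIntegral.integral_of_le (by norm_num),
    vol, restrict_Ioo_eq_restrict_Ioc]

theorem primitive_vol_eq_sub_of_hasDerivAt [CompleteSpace E] {u u' : ℝ → E}
    (h : ∀ t, HasDerivAt u (u' t) t) (hc : Continuous u') {t : ℝ} (ht : t ∈ Set.Icc (-1 : ℝ) 1) :
    primitive vol u' t = u t - u (-1) := by
  rw [primitive_vol_eq_intervalIntegral _ ht]
  exact intervalIntegral.integral_eq_sub_of_hasDerivAt (fun s _ => h s) (hc.intervalIntegrable _ _)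

end Primitive

/-! ### The du Bois-Reymond lemma -/

section DuBoisReymond

variable {a b : ℝ}

theorem exists_contDiff_integral_eq_one (hab : a < b) :
    ∃ η : ℝ → ℝ, ContDiff ℝ ∞ η ∧ HasCompactSupport η ∧ tsupport η ⊆ Set.Ioo a b ∧
      ∫ t, η t = 1 := by
  let bump : ContDiffBump ((a + b) / 2) :=
    ⟨(b - a) / 8, (b - a) / 4, by linarith, by linarith⟩
  refine ⟨bump.normed volume, bump.contDiff_normed, bump.hasCompactSupport_normed, ?_,
    bump.integral_normed⟩
  rw [bump.tsupport_normed_eq, Real.closedBall_eq_Icc]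
  exact Set.Icc_subset_Ioo (by change a < _ - (b - a) / 4; linarith)
    (by change _ + (b - a) / 4 < b; linarith)

theorem exists_deriv_eq_of_integral_eq_zero {θ : ℝ → ℝ} (hθ : ContDiff ℝ ∞ θ)
    (hcpt : HasCompactSupport θ) (hsupp : tsupport θ ⊆ Set.Ioo a b) (hint : ∫ t, θ t = 0) :
    ∃ Θ : ℝ → ℝ, ContDiff ℝ ∞ Θ ∧ HasCompactSupport Θ ∧ tsupport Θ ⊆ Set.Ioo a b ∧
      deriv Θ = θ := by
  rcases (tsupport θ).eq_empty_or_nonempty with hempty | hne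
  · have hzero : θ = 0 := tsupport_eq_empty_iff.1 hempty
    exact ⟨0, contDiff_const, HasCompactSupport.zero, by simp [tsupport], by simp [hzero]⟩
  obtain ⟨c, hc, hcmin⟩ := hcpt.isCompact.exists_isLeast hne
  obtain ⟨d, hd, hdmax⟩ := hcpt.isCompact.exists_isGreatest hne
  have hac : a < c := (hsupp hc).1
  have hdb : d < b := (hsupp hd).2
  have vanish_left {t : ℝ} (ht : t < c) : θ t = 0 :=
    image_eq_zero_of_notMem_tsupport fun h => (hcmin h).not_gt ht
  have hsub : Function.support θ ⊆ Set.Ioc a d := fun t ht =>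
    ⟨(hsupp (subset_tsupport _ ht)).1, hdmax (subset_tsupport _ ht)⟩
  have hderiv : deriv (fun t => ∫ s in a..t, θ s) = θ :=
    funext fun t => hθ.continuous.deriv_integral _ _ _
  have hΘsupp : tsupport (fun t => ∫ s in a..t, θ s) ⊆ Set.Icc c d := by
    refine closure_minimal (fun t ht => ?_) isClosed_Icc
    contrapose! ht
    rw [Function.notMem_support]
    rcases lt_or_ge t c with htc | hct
    · refine intervalIntegral.integral_zero_ae (Filter.Eventually.of_forall fun s hs => ?_)
      exact vanish_left ((Set.mem_uIoc.1 hs).elim (fun h => h.2.trans_lt htc)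
        fun h => h.2.trans_lt hac)
    · have hdt : d ≤ t := le_of_not_ge fun h => ht ⟨hct, h⟩
      rw [intervalIntegral.integral_eq_integral_of_support_subset
        (hsub.trans (Set.Ioc_subset_Ioc_right hdt)), hint]
  refine ⟨_, contDiff_infty_iff_deriv.2 ⟨fun t => ?_, hderiv.symm ▸ hθ⟩,
    isCompact_Icc.of_isClosed_subset (isClosed_tsupport _) hΘsupp,
    hΘsupp.trans (Set.Icc_subset_Ioo hac hdb), hderiv⟩
  exact (hθ.continuous.integral_hasStrictDerivAt a t).hasDerivAt.differentiableAt

theorem exists_deriv_eq_sub_integral_smul {φ η : ℝ → ℝ} (hφ : ContDiff ℝ ∞ φ)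
    (hφcpt : HasCompactSupport φ) (hφsupp : tsupport φ ⊆ Set.Ioo a b) (hη : ContDiff ℝ ∞ η)
    (hηcpt : HasCompactSupport η) (hηsupp : tsupport η ⊆ Set.Ioo a b) (hηint : ∫ t, η t = 1) :
    ∃ Θ : ℝ → ℝ, ContDiff ℝ ∞ Θ ∧ HasCompactSupport Θ ∧ tsupport Θ ⊆ Set.Ioo a b ∧
      deriv Θ = φ - (∫ t, φ t) • η := by
  refine exists_deriv_eq_of_integral_eq_zero (hφ.sub (contDiff_const.smul hη))
    (hφcpt.sub hηcpt.smul_left) ((tsupport_sub _ _).trans (Set.union_subset hφsupp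
      ((tsupport_smul_subset_right (fun _ => ∫ t, φ t) η).trans hηsupp))) ?_
  simp only [Pi.sub_apply, Pi.smul_apply, smul_eq_mul]
  rw [integral_sub (hφ.continuous.integrable_of_hasCompactSupport hφcpt)
    ((hη.continuous.integrable_of_hasCompactSupport hηcpt).const_mul _), integral_const_mul, hηint,
    mul_one, sub_self]

theorem ae_eq_const_of_integral_deriv_smul_eq_zero {E : Type*} [NormedAddCommGroup E]
    [NormedSpace ℝ E] [CompleteSpace E] (hab : a < b) {f : ℝ → E}
    (hf : IntegrableOn f (Set.Ioo a b))
    (h : ∀ φ : ℝ → ℝ, ContDiff ℝ ∞ φ → HasCompactSupport φ → tsupport φ ⊆ Set.Ioo a b →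
      ∫ t in Set.Ioo a b, deriv φ t • f t = 0) :
    ∃ c : E, f =ᵐ[volume.restrict (Set.Ioo a b)] fun _ => c := by
  obtain ⟨η, hη, hηcpt, hηsupp, hηint⟩ := exists_contDiff_integral_eq_one hab
  have integrable_test_smul {φ : ℝ → ℝ} (hφ : Continuous φ) (hcpt : HasCompactSupport φ) :
      IntegrableOn (fun t => φ t • f t) (Set.Ioo a b) := by
    obtain ⟨C, hC⟩ := hcpt.exists_bound_of_continuous hφ
    exact hf.bdd_smul C hφ.aestronglyMeasurable (Filter.Eventually.of_forall hC)
  set c : E := ∫ t in Set.Ioo a b, η t • f t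
  have hfc : IntegrableOn (fun t => f t - c) (Set.Ioo a b) := hf.sub (integrable_const c)
  suffices key : ∀ φ : ℝ → ℝ, ContDiff ℝ ∞ φ → HasCompactSupport φ → tsupport φ ⊆ Set.Ioo a b →
      ∫ t in Set.Ioo a b, φ t • (f t - c) = 0 by
    refine ⟨c, ?_⟩
    filter_upwards [isOpen_Ioo.ae_eq_zero_of_integral_contDiff_smul_eq_zero
      (μ := volume.restrict (Set.Ioo a b)) (hfc.locallyIntegrable.locallyIntegrableOn _) key,
      ae_restrict_mem measurableSet_Ioo] with t ht hmem
    exact sub_eq_zero.1 (ht hmem)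
  intro φ hφ hφcpt hφsupp
  have hint : ∫ t in Set.Ioo a b, φ t = ∫ t, φ t := setIntegral_eq_integral_of_forall_compl_eq_zero
    fun t ht => image_eq_zero_of_notMem_tsupport fun h => ht (hφsupp h)
  obtain ⟨Θ, hΘ, hΘcpt, hΘsupp, hderiv⟩ :=
    exists_deriv_eq_sub_integral_smul hφ hφcpt hφsupp hη hηcpt hηsupp hηint
  have hortho := h Θ hΘ hΘcpt hΘsupp
  simp only [hderiv, Pi.sub_apply, Pi.smul_apply, sub_smul, smul_assoc] at hortho
  rw [integral_sub (integrable_test_smul hφ.continuous hφcpt)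
    ((integrable_test_smul hη.continuous hηcpt).fun_smul _), integral_smul] at hortho
  simp only [smul_sub]
  rw [integral_sub (integrable_test_smul hφ.continuous hφcpt)
    ((hφ.continuous.integrable_of_hasCompactSupport hφcpt).integrableOn.smul_const c),
    integral_smul_const, hint, hortho]

end DuBoisReymond

/-! ### Weak derivatives -/

theorem integrable_coe (f : L2) : Integrable (fun t => f t) vol :=
  (Lp.memLp f).integrable (by norm_num)

theorem memLp_of_continuous {E : Type*} [NormedAddCommGroup E] {u : ℝ → E} (hu : Continuous u)
    (p : ENNReal) : MemLp u p vol := by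
  obtain ⟨C, hC⟩ := isCompact_Icc.exists_bound_of_continuousOn (s := Set.Icc (-1 : ℝ) 1)
    hu.continuousOn
  refine MemLp.of_bound hu.aestronglyMeasurable C ?_
  filter_upwards [ae_restrict_mem measurableSet_Ioo] with t ht
  exact hC t (Set.Ioo_subset_Icc_self ht)

theorem integral_deriv_smul_add_primitive {E : Type*} [NormedAddCommGroup E] [NormedSpace ℝ E]
    [CompleteSpace E] {φ : ℝ → ℝ} (hφ : ContDiff ℝ ∞ φ)
    (hsupp : tsupport φ ⊆ Set.Ioo (-1 : ℝ) 1) {g : ℝ → E} (hg : Integrable g vol) (c : E) :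
    ∫ t, deriv φ t • (c + primitive vol g t) ∂vol = -∫ t, φ t • g t ∂vol := by
  have hφ' : Continuous (deriv φ) := hφ.continuous_deriv (by simp)
  have hvanish {t : ℝ} (ht : t ∉ Set.Ioo (-1 : ℝ) 1) : φ t = 0 :=
    image_eq_zero_of_notMem_tsupport fun h => ht (hsupp h)
  have hprim {t : ℝ} (ht : t ∈ Set.Icc (-1 : ℝ) 1) : primitive vol (deriv φ) t = φ t := by
    rw [primitive_vol_eq_sub_of_hasDerivAt
      (fun t => (hφ.differentiable (by simp) t).hasDerivAt) hφ' ht, hvanish (t := -1) (by simp),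
      sub_zero]
  have hint : ∫ t, deriv φ t ∂vol = 0 := by
    rw [← primitive_vol_one, hprim (by simp), hvanish (t := 1) (by simp)]
  have hfirst : ∫ t, (0 + primitive vol (deriv φ) t) • g t ∂vol = ∫ t, φ t • g t ∂vol :=
    setIntegral_congr_fun measurableSet_Ioo fun t ht => by
      simp only [zero_add, hprim (Set.Ioo_subset_Icc_self ht)]
  have hparts := integral_bilin_add_primitive (ContinuousLinearMap.lsmul ℝ ℝ (E := E))
    (memLp_one_iff_integrable.1 (memLp_of_continuous hφ' 1)) hg 0 c
  simp only [ContinuousLinearMap.lsmul_apply, hint, hfirst, add_zero, zero_smul, sub_zero]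
    at hparts
  exact eq_neg_of_add_eq_zero_left hparts

theorem hasWeakDeriv_iff_exists_ae_eq {f g : L2} :
    HasWeakDeriv f g ↔ ∃ c : C2, f =ᵐ[vol] fun t => c + primitive vol g t := by
  constructor
  · intro h
    have hprim : Integrable (primitive vol g) vol :=
      memLp_one_iff_integrable.1 (memLp_of_continuous (continuous_primitive (integrable_coe g)) 1)
    obtain ⟨c, hc⟩ := ae_eq_const_of_integral_deriv_smul_eq_zero (by norm_num)
      ((integrable_coe f).sub hprim) fun φ hφ hcpt hsupp => by
        have hφ' := hφ.continuous_deriv (by simp)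
        have hφprim : Integrable (fun t => deriv φ t • primitive vol g t) vol :=
          memLp_one_iff_integrable.1 (memLp_of_continuous
            (hφ'.smul (continuous_primitive (integrable_coe g))) 1)
        have hweak := integral_deriv_smul_add_primitive hφ hsupp (integrable_coe g) 0
        simp only [zero_add] at hweak
        simp only [Pi.sub_apply, smul_sub]
        rw [integral_sub (integrable_smul hφ' hcpt.deriv f) hφprim, hweak, h φ hφ hcpt hsupp,
          sub_self]
    exact ⟨c, hc.mono fun t ht => sub_eq_iff_eq_add.1 ht⟩
  · rintro ⟨c, hc⟩ φ hφ - hsupp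
    rw [← integral_deriv_smul_add_primitive hφ hsupp (integrable_coe g) c]
    exact integral_congr_ae (hc.mono fun t ht => by simp only [ht])

theorem isContRep_of_ae_eq {f g : L2} {c : C2} (h : f =ᵐ[vol] fun t => c + primitive vol g t) :
    IsContRep f (fun t => c + primitive vol g t) :=
  ⟨(continuous_const.add (continuous_primitive (integrable_coe g))).continuousOn, h⟩

theorem HasWeakDeriv.exists_isContRep {f g : L2} (h : HasWeakDeriv f g) : ∃ u, IsContRep f u :=
  (hasWeakDeriv_iff_exists_ae_eq.1 h).imp' _ fun _ hc => isContRep_of_ae_eq hc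

theorem IsContRep.eqOn {f : L2} {u v : ℝ → C2} (hu : IsContRep f u) (hv : IsContRep f v) :
    Set.EqOn u v (Set.Icc (-1) 1) := by
  refine Measure.eqOn_Icc_of_ae_eq volume (by norm_num) ?_ hu.1 hv.1
  rw [← restrict_Ioo_eq_restrict_Icc]
  exact hu.2.symm.trans hv.2

theorem HasWeakDeriv.eq_add_primitive {f g : L2} (h : HasWeakDeriv f g) {u : ℝ → C2}
    (hu : IsContRep f u) {t : ℝ} (ht : t ∈ Set.Icc (-1 : ℝ) 1) :
    u t = u (-1) + primitive vol g t := by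
  obtain ⟨c, hc⟩ := hasWeakDeriv_iff_exists_ae_eq.1 h
  have hEq := hu.eqOn (isContRep_of_ae_eq hc)
  rw [hEq ht, hEq (by simp : (-1 : ℝ) ∈ Set.Icc (-1 : ℝ) 1)]
  simp only [primitive_vol_neg_one, add_zero]

theorem HasWeakDeriv.inner_add_inner {f f' g g' : L2} (hf : HasWeakDeriv f f')
    (hg : HasWeakDeriv g g') {u v : ℝ → C2} (hu : IsContRep f u) (hv : IsContRep g v) :
    inner ℂ f' g + inner ℂ f g' = inner ℂ (u 1) (v 1) - inner ℂ (u (-1)) (v (-1)) := by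
  have hparts := integral_bilin_add_primitive
    (isBoundedBilinearMap_inner (𝕜 := ℂ) (E := C2)).toContinuousLinearMap
    (integrable_coe f') (integrable_coe g') (u (-1)) (v (-1))
  rw [← primitive_vol_one f', ← primitive_vol_one g', ← hf.eq_add_primitive hu (by simp),
    ← hg.eq_add_primitive hv (by simp)] at hparts
  rw [L2.inner_def, L2.inner_def]
  refine Eq.trans ?_ hparts
  congr 1 <;> refine integral_congr_ae ?_
  · filter_upwards [ae_restrict_mem measurableSet_Ioo, hv.2] with t ht hvt
    rw [hvt, hg.eq_add_primitive hv (Set.Ioo_subset_Icc_self ht)]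
    rfl
  · filter_upwards [ae_restrict_mem measurableSet_Ioo, hu.2] with t ht hut
    rw [hut, hf.eq_add_primitive hu (Set.Ioo_subset_Icc_self ht)]
    rfl

/-! ### Multiplication by constant matrices -/

/-- The action of a matrix on `ℂ²`; `matMul A` is the pointwise action of `matCLM A`. -/
abbrev matCLM (A : Matrix (Fin 2) (Fin 2) ℂ) : C2 →L[ℂ] C2 := Matrix.toEuclideanCLM (𝕜 := ℂ) A

theorem matCLM_apply_zero (A : Matrix (Fin 2) (Fin 2) ℂ) (v : C2) :
    matCLM A v 0 = A 0 0 * v 0 + A 0 1 * v 1 := by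
  simp [Matrix.ofLp_toEuclideanCLM, Matrix.mulVec, dotProduct, Fin.sum_univ_two]

theorem matCLM_apply_one (A : Matrix (Fin 2) (Fin 2) ℂ) (v : C2) :
    matCLM A v 1 = A 1 0 * v 0 + A 1 1 * v 1 := by
  simp [Matrix.ofLp_toEuclideanCLM, Matrix.mulVec, dotProduct, Fin.sum_univ_two]

theorem matCLM_mul_apply (A B : Matrix (Fin 2) (Fin 2) ℂ) (v : C2) :
    matCLM (A * B) v = matCLM A (matCLM B v) := by
  simp

theorem inner_matCLM (A : Matrix (Fin 2) (Fin 2) ℂ) (v w : C2) :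
    inner ℂ (matCLM A v) w = inner ℂ v (matCLM Aᴴ w) := by
  have h : matCLM Aᴴ = ContinuousLinearMap.adjoint (matCLM A) := by
    rw [← ContinuousLinearMap.star_eq_adjoint, matCLM, matCLM, ← map_star,
      Matrix.star_eq_conjTranspose]
  rw [h, ContinuousLinearMap.adjoint_inner_right]

theorem coeFn_matMul (A : Matrix (Fin 2) (Fin 2) ℂ) (f : L2) :
    matMul A f =ᵐ[vol] fun t => matCLM A (f t) :=
  ContinuousLinearMap.coeFn_compLpL _ _

theorem matMul_mul (A B : Matrix (Fin 2) (Fin 2) ℂ) (f : L2) :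
    matMul (A * B) f = matMul A (matMul B f) := by
  refine Lp.ext ?_
  filter_upwards [coeFn_matMul (A * B) f, coeFn_matMul A (matMul B f), coeFn_matMul B f]
    with t hAB hA hB
  rw [hAB, hA, hB, matCLM_mul_apply]

theorem matMul_one (f : L2) : matMul 1 f = f := by
  refine Lp.ext ?_
  filter_upwards [coeFn_matMul 1 f] with t ht
  rw [ht, matCLM, map_one, one_apply_eq_self]

theorem matMul_smul (c : ℂ) (A : Matrix (Fin 2) (Fin 2) ℂ) (f : L2) :
    matMul (c • A) f = c • matMul A f := by
  rw [matMul, matMul, map_smul, ContinuousLinearMap.smul_compLpL, smul_apply]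

theorem inner_matMul (A : Matrix (Fin 2) (Fin 2) ℂ) (f g : L2) :
    inner ℂ (matMul A f) g = inner ℂ f (matMul Aᴴ g) := by
  rw [L2.inner_def, L2.inner_def]
  refine integral_congr_ae ?_
  filter_upwards [coeFn_matMul A f, coeFn_matMul Aᴴ g] with t hf hg
  rw [hf, hg, inner_matCLM]

theorem norm_matMul {A : Matrix (Fin 2) (Fin 2) ℂ} (hA : Aᴴ * A = 1) (f : L2) :
    ‖matMul A f‖ = ‖f‖ := by
  rw [@norm_eq_sqrt_re_inner ℂ, @norm_eq_sqrt_re_inner ℂ, inner_matMul, ← matMul_mul, hA,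
    matMul_one]

theorem HasWeakDeriv.comp_realCLM (L : C2 →L[ℝ] C2) {f g F G : L2} (h : HasWeakDeriv f g)
    (hF : F =ᵐ[vol] fun t => L (f t)) (hG : G =ᵐ[vol] fun t => L (g t)) : HasWeakDeriv F G := by
  have pull_out {φ : ℝ → ℝ} (hφ : Continuous φ) (hcpt : HasCompactSupport φ) {k K : L2}
      (hK : K =ᵐ[vol] fun t => L (k t)) :
      ∫ t, φ t • K t ∂vol = L (∫ t, φ t • k t ∂vol) := by
    rw [← L.integral_comp_comm (integrable_smul hφ hcpt k)]
    exact integral_congr_ae (hK.mono fun t ht => by simp only [ht, map_smul])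
  intro φ hφ hcpt hsupp
  rw [pull_out (hφ.continuous_deriv (by simp)) hcpt.deriv hF, pull_out hφ.continuous hcpt hG,
    h φ hφ hcpt hsupp, map_neg]

theorem HasWeakDeriv.matMul {f g : L2} (h : HasWeakDeriv f g) (A : Matrix (Fin 2) (Fin 2) ℂ) :
    HasWeakDeriv (matMul A f) (matMul A g) :=
  h.comp_realCLM ((matCLM A).restrictScalars ℝ) (coeFn_matMul A f) (coeFn_matMul A g)

theorem IsContRep.matMul {f : L2} {u : ℝ → C2} (h : IsContRep f u)
    (A : Matrix (Fin 2) (Fin 2) ℂ) : IsContRep (matMul A f) (fun t => matCLM A (u t)) := by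
  refine ⟨(matCLM A).continuous.comp_continuousOn h.1, ?_⟩
  filter_upwards [coeFn_matMul A f, h.2] with t hA hu
  rw [hA, hu]

/-! ### Algebra of the coefficient matrices -/

section Coefficients

variable {x : EuclideanSpace ℝ (Fin 2)}

theorem toC_mul_conj (hx : ‖x‖ = 1) : toC x * (starRingEnd ℂ) (toC x) = 1 := by
  have hsum : x 0 ^ 2 + x 1 ^ 2 = 1 := by
    have h := EuclideanSpace.real_norm_sq_eq x
    rwa [hx, one_pow, Fin.sum_univ_two, eq_comm] at h
  have hsum' : (x 0 : ℂ) ^ 2 + (x 1 : ℂ) ^ 2 = 1 := by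
    rw [← Complex.ofReal_pow, ← Complex.ofReal_pow, ← Complex.ofReal_add, hsum, Complex.ofReal_one]
  simp only [toC, map_add, map_mul, Complex.conj_ofReal, Complex.conj_I]
  linear_combination hsum' - (x 1 : ℂ) ^ 2 * Complex.I_sq

theorem conj_toC_mul (hx : ‖x‖ = 1) : (starRingEnd ℂ) (toC x) * toC x = 1 := by
  rw [mul_comm, toC_mul_conj hx]

theorem pauliDot_eq (x : EuclideanSpace ℝ (Fin 2)) :
    pauliDot x = !![0, (starRingEnd ℂ) (toC x); toC x, 0] := by
  ext i j
  fin_cases i <;> fin_cases j <;> simp [pauliDot, pauli1, pauli2, toC] <;> ring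

/-- The Hermitian involution `i (σ · x) σ₃`. The boundary conditions say that the boundary values
at `±1` are eigenvectors of it for the eigenvalue `±1`. -/
def swapMat (x : EuclideanSpace ℝ (Fin 2)) : Matrix (Fin 2) (Fin 2) ℂ :=
  !![0, -(Complex.I * (starRingEnd ℂ) (toC x)); Complex.I * toC x, 0]

theorem pauliDot_conjTranspose (x : EuclideanSpace ℝ (Fin 2)) : (pauliDot x)ᴴ = pauliDot x := by
  rw [pauliDot_eq]
  ext i j
  fin_cases i <;> fin_cases j <;> simp [Matrix.conjTranspose_apply]

theorem swapMat_conjTranspose (x : EuclideanSpace ℝ (Fin 2)) : (swapMat x)ᴴ = swapMat x := by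
  ext i j
  fin_cases i <;> fin_cases j <;> simp [swapMat, Matrix.conjTranspose_apply]

theorem pauli3_conjTranspose : pauli3ᴴ = pauli3 := by
  ext i j
  fin_cases i <;> fin_cases j <;> simp [pauli3, Matrix.conjTranspose_apply]

theorem pauli3_mul_self : pauli3 * pauli3 = 1 := by
  ext i j
  fin_cases i <;> fin_cases j <;> simp [pauli3]

theorem pauliDot_mul_self (hx : ‖x‖ = 1) : pauliDot x * pauliDot x = 1 := by
  rw [pauliDot_eq]
  ext i j
  fin_cases i <;> fin_cases j <;> simp [toC_mul_conj hx, conj_toC_mul hx]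

theorem pauliDot_mul_pauli3 (x : EuclideanSpace ℝ (Fin 2)) :
    pauliDot x * pauli3 = -Complex.I • swapMat x := by
  rw [pauliDot_eq]
  ext i j
  fin_cases i <;> fin_cases j <;> simp [swapMat, pauli3, ← mul_assoc]

theorem swapMat_eq (x : EuclideanSpace ℝ (Fin 2)) :
    swapMat x = Complex.I • (pauliDot x * pauli3) := by
  rw [pauliDot_mul_pauli3, smul_smul, mul_neg, Complex.I_mul_I, neg_neg, one_smul]

theorem pauli3_mul_pauliDot (x : EuclideanSpace ℝ (Fin 2)) :
    pauli3 * pauliDot x = -(pauliDot x * pauli3) := by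
  rw [pauliDot_eq]
  ext i j
  fin_cases i <;> fin_cases j <;> simp [pauli3]

theorem pauliDot_mul_swapMat (hx : ‖x‖ = 1) : pauliDot x * swapMat x = Complex.I • pauli3 := by
  rw [swapMat_eq, mul_smul_comm, ← mul_assoc, pauliDot_mul_self hx, one_mul]

theorem swapMat_mul_pauliDot (hx : ‖x‖ = 1) :
    swapMat x * pauliDot x = -(Complex.I • pauli3) := by
  rw [swapMat_eq, smul_mul_assoc, mul_assoc, pauli3_mul_pauliDot, mul_neg, ← mul_assoc,
    pauliDot_mul_self hx, one_mul, smul_neg]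

theorem swapMat_mul_pauli3 (x : EuclideanSpace ℝ (Fin 2)) :
    swapMat x * pauli3 = -(pauli3 * swapMat x) := by
  rw [swapMat_eq, smul_mul_assoc, mul_smul_comm, ← mul_assoc, pauli3_mul_pauliDot, neg_mul,
    smul_neg, neg_neg]

theorem swapMat_mul_self (hx : ‖x‖ = 1) : swapMat x * swapMat x = 1 := by
  nth_rw 1 [swapMat_eq]
  rw [smul_mul_assoc, mul_assoc, ← neg_eq_iff_eq_neg.2 (swapMat_mul_pauli3 x), mul_neg, ← mul_assoc,
    pauliDot_mul_swapMat hx, smul_mul_assoc, pauli3_mul_self, smul_neg, smul_smul,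
    Complex.I_mul_I, neg_smul, neg_neg, one_smul]

theorem matCLM_swapMat_apply_zero (v : C2) :
    matCLM (swapMat x) v 0 = -(Complex.I * (starRingEnd ℂ) (toC x) * v 1) := by
  simp [matCLM_apply_zero, swapMat]

theorem matCLM_swapMat_apply_one (v : C2) :
    matCLM (swapMat x) v 1 = Complex.I * toC x * v 0 := by
  simp [matCLM_apply_one, swapMat]

theorem matCLM_swapMat_eq_smul_iff (hx : ‖x‖ = 1) {s : ℂ} (hs : s * s = 1) (v : C2) :
    matCLM (swapMat x) v = s • v ↔ v 1 = s * (Complex.I * toC x * v 0) := by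
  constructor
  · intro h
    have h1 : Complex.I * toC x * v 0 = s * v 1 := by
      rw [← matCLM_swapMat_apply_one, h, PiLp.smul_apply, smul_eq_mul]
    linear_combination -v 1 * hs - s * h1
  · intro h
    ext i
    fin_cases i
    · change matCLM (swapMat x) v 0 = s * v 0
      rw [matCLM_swapMat_apply_zero, h]
      linear_combination -Complex.I ^ 2 * s * v 0 * toC_mul_conj hx - s * v 0 * Complex.I_sq
    · change matCLM (swapMat x) v 1 = s * v 1
      rw [matCLM_swapMat_apply_one, h]
      linear_combination -(Complex.I * toC x * v 0) * hs

theorem boundaryCond_iff (hx : ‖x‖ = 1) {u : ℝ → C2} :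
    BoundaryCond x u ↔
      matCLM (swapMat x) (u 1) = u 1 ∧ matCLM (swapMat x) (u (-1)) = -u (-1) := by
  have hplus := matCLM_swapMat_eq_smul_iff hx (mul_one 1) (u 1)
  have hminus := matCLM_swapMat_eq_smul_iff hx (by norm_num : (-1 : ℂ) * -1 = 1) (u (-1))
  rw [one_smul, one_mul] at hplus
  rw [neg_one_smul, neg_one_mul] at hminus
  rw [hplus, hminus, BoundaryCond]

theorem inner_matCLM_eq_zero_of_anticommute {J S : Matrix (Fin 2) (Fin 2) ℂ} (hJ : Jᴴ = J)
    (hJS : J * S = -(S * J)) {s : ℝ} (hs : s ≠ 0) {v w : C2}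
    (hv : matCLM J v = (s : ℂ) • v) (hw : matCLM J w = (s : ℂ) • w) :
    inner ℂ v (matCLM S w) = 0 := by
  have h : (s : ℂ) * inner ℂ v (matCLM S w) = -((s : ℂ) * inner ℂ v (matCLM S w)) :=
    calc (s : ℂ) * inner ℂ v (matCLM S w) = inner ℂ (matCLM J v) (matCLM S w) := by
          rw [hv, inner_smul_left, Complex.conj_ofReal]
      _ = -inner ℂ v (matCLM S (matCLM J w)) := by
          rw [inner_matCLM, hJ, ← matCLM_mul_apply, hJS, matCLM, map_neg, neg_apply,
            inner_neg_right, ← matCLM_mul_apply]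
      _ = -((s : ℂ) * inner ℂ v (matCLM S w)) := by rw [hw, map_smul, inner_smul_right]
  exact (mul_eq_zero.1 (self_eq_neg.1 h)).resolve_left (Complex.ofReal_ne_zero.2 hs)

end Coefficients

/-! ### Elementary properties of the transverse operator -/

section Elementary

variable {x : EuclideanSpace ℝ (Fin 2)}

theorem hasWeakDeriv_domDeriv (f : transverseDomain x) : HasWeakDeriv f (domDeriv x f) :=
  hasWeakDeriv_weakDeriv (Submodule.inclusion (transverseDomain_le x) f)

theorem boundaryCond_of_mem {f : L2} (hf : f ∈ transverseDomain x) {u : ℝ → C2}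
    (hu : IsContRep f u) : BoundaryCond x u := by
  obtain ⟨-, v, hv, hbc⟩ := hf
  have hEq := hu.eqOn hv
  rwa [BoundaryCond, hEq (by simp : (1 : ℝ) ∈ Set.Icc (-1 : ℝ) 1),
    hEq (by simp : (-1 : ℝ) ∈ Set.Icc (-1 : ℝ) 1)]

theorem transverseOp_apply (x : EuclideanSpace ℝ (Fin 2)) (δ : ℝ) (f : transverseDomain x) :
    transverseOp x δ f =
      (-Complex.I) • matMul (pauliDot x) (domDeriv x f) + (δ : ℂ) • matMul pauli3 f := rfl

theorem transverseOp_mk (δ : ℝ) {f g : L2} (hf : f ∈ transverseDomain x) (h : HasWeakDeriv f g) :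
    transverseOp x δ ⟨f, hf⟩ =
      (-Complex.I) • matMul (pauliDot x) g + (δ : ℂ) • matMul pauli3 f := by
  refine (transverseOp_apply x δ ⟨f, hf⟩).trans ?_
  rw [(hasWeakDeriv_domDeriv ⟨f, hf⟩).unique h]

theorem inner_transverseOp (hx : ‖x‖ = 1) (δ : ℝ) (f g : transverseDomain x) :
    inner ℂ (transverseOp x δ f) (g : L2) = inner ℂ (f : L2) (transverseOp x δ g) := by
  have hf := hasWeakDeriv_domDeriv f
  have hg := hasWeakDeriv_domDeriv g
  obtain ⟨u, hu⟩ := hf.exists_isContRep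
  obtain ⟨v, hv⟩ := hg.exists_isContRep
  obtain ⟨hu1, hu2⟩ := (boundaryCond_iff hx).1 (boundaryCond_of_mem f.2 hu)
  obtain ⟨hv1, hv2⟩ := (boundaryCond_iff hx).1 (boundaryCond_of_mem g.2 hv)
  have anticomm : swapMat x * pauliDot x = -(pauliDot x * swapMat x) := by
    rw [swapMat_mul_pauliDot hx, pauliDot_mul_swapMat hx]
  have boundary_one : inner ℂ (u 1) (matCLM (pauliDot x) (v 1)) = 0 :=
    inner_matCLM_eq_zero_of_anticommute (swapMat_conjTranspose x) anticomm one_ne_zero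
      (by simpa using hu1) (by simpa using hv1)
  have boundary_neg_one : inner ℂ (u (-1)) (matCLM (pauliDot x) (v (-1))) = 0 :=
    inner_matCLM_eq_zero_of_anticommute (swapMat_conjTranspose x) anticomm
      (neg_ne_zero.2 one_ne_zero) (by simpa using hu2) (by simpa using hv2)
  have hparts := hf.inner_add_inner (hg.matMul (pauliDot x)) hu (hv.matMul (pauliDot x))
  rw [boundary_one, boundary_neg_one, sub_zero] at hparts
  rw [transverseOp_apply, transverseOp_apply, inner_add_left, inner_add_right, inner_smul_left,
    inner_smul_left, inner_smul_right, inner_smul_right, inner_matMul, inner_matMul,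
    pauliDot_conjTranspose, pauli3_conjTranspose, map_neg, Complex.conj_I, Complex.conj_ofReal]
  linear_combination Complex.I * hparts

theorem two_mul_re_inner_domDeriv_swapMat (hx : ‖x‖ = 1) (f : transverseDomain x) {u : ℝ → C2}
    (hu : IsContRep (f : L2) u) :
    2 * RCLike.re (inner ℂ (domDeriv x f) (matMul (swapMat x) f)) =
      ‖u 1‖ ^ 2 + ‖u (-1)‖ ^ 2 := by
  have hf := hasWeakDeriv_domDeriv f
  obtain ⟨h1, h2⟩ := (boundaryCond_iff hx).1 (boundaryCond_of_mem f.2 hu)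
  have hswap : RCLike.re (inner ℂ (f : L2) (matMul (swapMat x) (domDeriv x f))) =
      RCLike.re (inner ℂ (domDeriv x f) (matMul (swapMat x) f)) := by
    rw [← inner_conj_symm, RCLike.conj_re, inner_matMul, swapMat_conjTranspose]
  have hparts := congrArg RCLike.re
    (hf.inner_add_inner (hf.matMul (swapMat x)) hu (hu.matMul (swapMat x)))
  rw [h1, h2, inner_neg_right, map_add, map_sub, map_neg, hswap, inner_self_eq_norm_sq,
    inner_self_eq_norm_sq] at hparts
  linear_combination hparts

theorem norm_sq_transverseOp (hx : ‖x‖ = 1) (δ : ℝ) (f : transverseDomain x) {u : ℝ → C2}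
    (hu : IsContRep (f : L2) u) :
    ‖transverseOp x δ f‖ ^ 2 =
      ‖domDeriv x f‖ ^ 2 + δ ^ 2 * ‖(f : L2)‖ ^ 2 + δ * (‖u 1‖ ^ 2 + ‖u (-1)‖ ^ 2) := by
  have cross : inner ℂ ((-Complex.I) • matMul (pauliDot x) (domDeriv x f))
      ((δ : ℂ) • matMul pauli3 (f : L2)) =
      (δ : ℂ) * inner ℂ (domDeriv x f) (matMul (swapMat x) f) := by
    rw [inner_smul_left, inner_smul_right, inner_matMul, pauliDot_conjTranspose, ← matMul_mul,
      pauliDot_mul_pauli3, matMul_smul, inner_smul_right, map_neg, Complex.conj_I]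
    linear_combination (-(δ : ℂ) * inner ℂ (domDeriv x f) (matMul (swapMat x) f)) * Complex.I_sq
  have norm_kinetic : ‖(-Complex.I) • matMul (pauliDot x) (domDeriv x f)‖ = ‖domDeriv x f‖ := by
    rw [norm_smul, norm_neg, Complex.norm_I, one_mul, norm_matMul]
    rw [pauliDot_conjTranspose, pauliDot_mul_self hx]
  have norm_mass : ‖(δ : ℂ) • matMul pauli3 (f : L2)‖ = |δ| * ‖(f : L2)‖ := by
    rw [norm_smul, norm_matMul (by rw [pauli3_conjTranspose, pauli3_mul_self]), Complex.norm_real,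
      Real.norm_eq_abs]
  have re_cross : RCLike.re ((δ : ℂ) * inner ℂ (domDeriv x f) (matMul (swapMat x) (f : L2))) =
      δ * RCLike.re (inner ℂ (domDeriv x f) (matMul (swapMat x) (f : L2))) :=
    RCLike.re_ofReal_mul _ _
  rw [transverseOp_apply, @norm_add_sq ℂ, cross, norm_kinetic, norm_mass, mul_pow, sq_abs, re_cross]
  linear_combination δ * two_mul_re_inner_domDeriv_swapMat hx f hu

theorem HasWeakDeriv.exists_ae_eq_const {f : L2} (h : HasWeakDeriv f 0) :
    ∃ c : C2, f =ᵐ[vol] fun _ => c := by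
  have hzero (t : ℝ) : primitive vol (0 : L2) t = 0 :=
    integral_eq_zero_of_ae (ae_restrict_of_ae (Lp.coeFn_zero C2 2 vol))
  simpa only [hzero, add_zero] using hasWeakDeriv_iff_exists_ae_eq.1 h

theorem eq_zero_of_domDeriv_eq_zero (hx : ‖x‖ = 1) {f : transverseDomain x}
    (h : domDeriv x f = 0) : f = 0 := by
  obtain ⟨c, hc⟩ := (h ▸ hasWeakDeriv_domDeriv f).exists_ae_eq_const
  obtain ⟨h1, h2⟩ := (boundaryCond_iff hx).1
    (boundaryCond_of_mem f.2 (⟨continuousOn_const, hc⟩ : IsContRep (f : L2) fun _ => c))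
  have hc0 : c = 0 := by
    have htwo : (2 : ℂ) • c = 0 := by
      rw [two_smul, add_eq_zero_iff_eq_neg]
      exact h1.symm.trans h2
    exact (smul_eq_zero.1 htwo).resolve_left two_ne_zero
  refine Subtype.ext ((Lp.eq_zero_iff_ae_eq_zero).2 ?_)
  filter_upwards [hc] with t ht
  rw [ht, hc0]
  rfl

theorem transverseOp_injective (hx : ‖x‖ = 1) {δ : ℝ} (hδ : 0 ≤ δ) {f : transverseDomain x}
    (h : transverseOp x δ f = 0) : f = 0 := by
  obtain ⟨u, hu⟩ := (hasWeakDeriv_domDeriv f).exists_isContRep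
  have hnorm := norm_sq_transverseOp hx δ f hu
  rw [h, norm_zero] at hnorm
  refine eq_zero_of_domDeriv_eq_zero hx (norm_eq_zero.1 (sq_eq_zero_iff.1 ?_))
  have : 0 ≤ δ * (‖u 1‖ ^ 2 + ‖u (-1)‖ ^ 2) := by positivity
  nlinarith [sq_nonneg ‖domDeriv x f‖, mul_nonneg (sq_nonneg δ) (sq_nonneg ‖(f : L2)‖)]

end Elementary

/-! ### Inverses of unbounded operators -/

section UnboundedOperators

variable {H : Type} [NormedAddCommGroup H]

section NormedSpace

variable [NormedSpace ℂ H] {T T' : H →ₗ.[ℂ] H} {R : H →L[ℂ] H} {z : ℂ}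

theorem isResolvent_zero_iff : IsResolvent T 0 R ↔
    (∀ y, ∃ h : R y ∈ T.domain, T ⟨R y, h⟩ = y) ∧ ∀ f : T.domain, R (T f) = f := by
  simp only [IsResolvent, zero_smul, sub_zero]

theorem isResolvent_zero_of_injective (hT : ∀ f : T.domain, T f = 0 → f = 0)
    (hR : ∀ y, ∃ h : R y ∈ T.domain, T ⟨R y, h⟩ = y) : IsResolvent T 0 R := by
  refine isResolvent_zero_iff.2 ⟨hR, fun f => ?_⟩
  obtain ⟨hmem, hTR⟩ := hR (T f)
  have hsub : T (⟨R (T f), hmem⟩ - f) = 0 := by rw [LinearPMap.map_sub, hTR, sub_self]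
  exact congrArg Subtype.val (sub_eq_zero.1 (hT _ hsub))

theorem IsResolvent.eq_comp {R' : H →L[ℂ] H} {w : ℂ} (hR : IsResolvent T z R)
    (hR' : IsResolvent T w R') :
    R' = R ∘L (ContinuousLinearMap.id ℂ H + (w - z) • R') := by
  ext y
  obtain ⟨hmem, hy⟩ := hR'.1 y
  refine (hR.2 ⟨R' y, hmem⟩).symm.trans (congrArg R ?_)
  rw [sub_eq_iff_eq_add.1 hy]
  change y + w • R' y - z • R' y = y + (w - z) • R' y
  rw [sub_smul, add_sub_assoc]

theorem hasCompactResolvent_of_isResolvent (hR : IsResolvent T z R) (hc : IsCompactOperator R) :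
    HasCompactResolvent T := by
  refine ⟨⟨z, R, hR⟩, fun w R' hR' => ?_⟩
  rw [hR.eq_comp hR']
  exact hc.comp_clm _

/-- `U` maps the domain of `T` into the domain of `T'` and `T' U = s U T` there. -/
def Intertwines (T T' : H →ₗ.[ℂ] H) (s : ℂ) (U : H →L[ℂ] H) : Prop :=
  ∀ f : T.domain, ∃ h : U f ∈ T'.domain, T' ⟨U f, h⟩ = s • U (T f)

theorem IsResolvent.conj {s : ℂ} (hs : s * s = 1) {U U' : H →L[ℂ] H}
    (hUU' : ∀ y, U (U' y) = y) (hU : Intertwines T T' s U) (hU' : Intertwines T' T s U')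
    (hR : IsResolvent T z R) : IsResolvent T' (s * z) (s • (U ∘L R ∘L U')) := by
  have hszs : s * z * s = z := by linear_combination z * hs
  constructor
  · intro y
    obtain ⟨h, hy⟩ := hR.1 (U' y)
    obtain ⟨h', hy'⟩ := hU ⟨R (U' y), h⟩
    refine ⟨T'.domain.smul_mem s h', ?_⟩
    refine (congrArg (· - (s * z) • s • U (R (U' y))) (T'.map_smul s ⟨U (R (U' y)), h'⟩)).trans ?_
    rw [hy', sub_eq_iff_eq_add.1 hy, smul_smul, hs, one_smul, map_add, hUU', map_smul, smul_smul,
      hszs, add_sub_cancel_right]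
  · intro f
    obtain ⟨h', hy'⟩ := hU' f
    have hinv := congrArg U (hR.2 ⟨U' f, h'⟩)
    simp only [hy', map_sub, map_smul, hUU'] at hinv
    simp only [smul_apply, ContinuousLinearMap.comp_apply, map_sub, map_smul]
    rwa [smul_smul (s * z) s, hszs]

theorem isUnit_one_sub_of_isCompactOperator [CompleteSpace H] {K : H →L[ℂ] H}
    (hK : IsCompactOperator K) (hfix : ∀ y, K y = y → y = 0) : IsUnit (1 - K) := by
  have hne : ¬ Module.End.HasEigenvalue (K : H →ₗ[ℂ] H) 1 := fun h => by
    obtain ⟨y, hy⟩ := h.exists_hasEigenvector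
    exact hy.2 (hfix y (by simpa using hy.apply_eq_smul))
  simpa [_root_.resolventSet] using
    (hK.hasEigenvalue_or_mem_resolventSet one_ne_zero).resolve_left hne

/-- A parametrix is an inverse up to a compact error: `T R = 1 + B R`. By the Fredholm
alternative `1 + B R` is invertible when `T` is injective, and `R (1 + B R)⁻¹` inverts `T`. -/
theorem exists_isResolvent_zero_of_parametrix [CompleteSpace H]
    (hT : ∀ f : T.domain, T f = 0 → f = 0) (hR : IsCompactOperator R) (B : H →L[ℂ] H)
    (hTR : ∀ y, ∃ h : R y ∈ T.domain, T ⟨R y, h⟩ = y + B (R y)) :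
    ∃ R' : H →L[ℂ] H, IsResolvent T 0 R' ∧ IsCompactOperator R' := by
  have hfix (y : H) (hy : (-(B ∘L R)) y = y) : y = 0 := by
    obtain ⟨hmem, hTy⟩ := hTR y
    have hBR : B (R y) = -y := neg_eq_iff_eq_neg.1 hy
    rw [hBR, add_neg_cancel] at hTy
    have hRy : R y = 0 := congrArg Subtype.val (hT _ hTy)
    rw [hRy, map_zero] at hBR
    exact neg_eq_zero.1 hBR.symm
  obtain ⟨⟨A, A', hAA', -⟩, rfl : A = 1 - -(B ∘L R)⟩ :=
    isUnit_one_sub_of_isCompactOperator (hR.clm_comp B).neg hfix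
  refine ⟨R ∘L A', isResolvent_zero_of_injective hT fun y => ?_, hR.comp_clm A'⟩
  obtain ⟨hmem, hTy⟩ := hTR (A' y)
  refine ⟨hmem, hTy.trans ?_⟩
  simpa using congrArg (fun L : H →L[ℂ] H => L y) hAA'

end NormedSpace

section InnerProductSpace

variable [InnerProductSpace ℂ H] {T : H →ₗ.[ℂ] H} {R : H →L[ℂ] H}

theorem dense_domain_of_isResolvent_zero [CompleteSpace H] (hR : IsResolvent T 0 R)
    (hT : T.IsFormalAdjoint T) : Dense (T.domain : Set H) := by
  have hTR := (isResolvent_zero_iff.1 hR).1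
  rw [Submodule.dense_iff_topologicalClosure_eq_top, Submodule.topologicalClosure_eq_top_iff,
    Submodule.eq_bot_iff]
  intro f hf
  obtain ⟨hRf, hTRf⟩ := hTR f
  obtain ⟨hRRf, hTRRf⟩ := hTR (R f)
  have hsymm := hT ⟨R f, hRf⟩ ⟨R (R f), hRRf⟩
  rw [hTRf, hTRRf, Submodule.inner_left_of_mem_orthogonal hRRf hf] at hsymm
  have hzero : (⟨R f, hRf⟩ : T.domain) = 0 := Subtype.ext (inner_self_eq_zero.1 hsymm.symm)
  rw [← hTRf, hzero, T.map_zero]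

/-- A symmetric operator has no proper symmetric extension once it is surjective. -/
theorem isSelfAdjoint_of_isResolvent_zero [CompleteSpace H] (hR : IsResolvent T 0 R)
    (hT : T.IsFormalAdjoint T) : IsSelfAdjoint T := by
  have hTR := (isResolvent_zero_iff.1 hR).1
  have hdense := dense_domain_of_isResolvent_zero hR hT
  refine LinearPMap.isSelfAdjoint_def.2 (le_antisymm (LinearPMap.le_of_le_graph ?_)
    (LinearPMap.IsFormalAdjoint.le_adjoint hdense hT))
  rintro ⟨g, w⟩ hgw
  obtain ⟨⟨g, hg⟩, rfl, rfl⟩ := (LinearPMap.mem_graph_iff _).1 hgw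
  set w := T.adjoint ⟨g, hg⟩ with hw
  obtain ⟨hRw, hTRw⟩ := hTR w
  obtain ⟨hmem, hTmem⟩ := hTR (g - R w)
  have horth : inner ℂ (g - R w) (T ⟨_, hmem⟩) = 0 := by
    have hadj := LinearPMap.adjoint_isFormalAdjoint hdense ⟨g, hg⟩ ⟨_, hmem⟩
    have hsymm := hT ⟨R w, hRw⟩ ⟨_, hmem⟩
    rw [← hw] at hadj
    rw [hTRw] at hsymm
    rw [inner_sub_left, ← hadj, ← hsymm, sub_self]
  rw [hTmem, inner_self_eq_zero, sub_eq_zero] at horth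
  exact (LinearPMap.mem_graph_iff _).2 ⟨⟨R w, hRw⟩, horth.symm, hTRw⟩

end InnerProductSpace

end UnboundedOperators

/-! ### The inverse of the transverse operator -/

theorem norm_setIntegral_le_sqrt_mul_norm {α E : Type*} [MeasurableSpace α] {μ : Measure α}
    [NormedAddCommGroup E] [InnerProductSpace ℝ E] [CompleteSpace E] {s : Set α}
    (hs : MeasurableSet s) (hμs : μ s ≠ ⊤) (f : Lp E 2 μ) :
    ‖∫ t in s, f t ∂μ‖ ≤ √(μ.real s) * ‖f‖ := by
  set I := ∫ t in s, f t ∂μ with hI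
  rcases (norm_nonneg I).eq_or_lt with hzero | hpos
  · rw [← hzero]
    positivity
  refine le_of_mul_le_mul_left ?_ hpos
  calc ‖I‖ * ‖I‖ = inner ℝ (indicatorConstLp 2 hs hμs I) f := by
        rw [L2.inner_indicatorConstLp_eq_inner_setIntegral, ← hI, real_inner_self_eq_norm_mul_norm]
    _ ≤ ‖indicatorConstLp 2 hs hμs I‖ * ‖f‖ := real_inner_le_norm _ _
    _ = ‖I‖ * (√(μ.real s) * ‖f‖) := by
        rw [norm_indicatorConstLp (by norm_num) (by norm_num), Real.sqrt_eq_rpow, mul_assoc]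
        norm_num

theorem dist_primitive_le (g : L2) (s t : ℝ) :
    dist (primitive vol g s) (primitive vol g t) ≤ √|s - t| * ‖g‖ := by
  wlog hst : s ≤ t generalizing s t
  · rw [dist_comm, abs_sub_comm]
    exact this t s (le_of_not_ge hst)
  rw [dist_comm, dist_eq_norm, primitive_sub_primitive (integrable_coe g) hst, abs_sub_comm,
    abs_of_nonneg (sub_nonneg.2 hst)]
  refine (norm_setIntegral_le_sqrt_mul_norm measurableSet_Ioc (measure_ne_top _ _) g).trans ?_
  gcongr
  rw [← Real.volume_real_Ioc_of_le hst]
  exact ENNReal.toReal_mono (by simp) (Measure.restrict_le_self _)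

theorem norm_primitive_le (g : L2) {t : ℝ} (ht : t ∈ Set.Icc (-1 : ℝ) 1) :
    ‖primitive vol g t‖ ≤ 2 * ‖g‖ := by
  have h := dist_primitive_le g t (-1)
  rw [primitive_vol_neg_one, dist_zero_right, sub_neg_eq_add, abs_of_nonneg (by linarith [ht.1])]
    at h
  refine h.trans (mul_le_mul_of_nonneg_right ?_ (norm_nonneg _))
  rw [Real.sqrt_le_left (by norm_num)]
  linarith [ht.2]

/-- The primitive of an element of `L²` that vanishes at `-1`, as a continuous function on
`[-1,1]`. -/
def primitiveLM : L2 →ₗ[ℂ] BoundedContinuousFunction (Set.Icc (-1 : ℝ) 1) C2 where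
  toFun g := BoundedContinuousFunction.mkOfCompact
    ⟨fun t => primitive vol g t,
      (continuous_primitive (integrable_coe g)).comp continuous_subtype_val⟩
  map_add' f g := by
    ext1 t
    exact (integral_congr_ae (ae_restrict_of_ae (Lp.coeFn_add f g))).trans
      (integral_add (integrable_coe f).integrableOn (integrable_coe g).integrableOn)
  map_smul' c f := by
    ext1 t
    exact (integral_congr_ae (ae_restrict_of_ae (Lp.coeFn_smul c f))).trans (integral_smul c _)

theorem isCompactOperator_primitiveLM : IsCompactOperator primitiveLM := by
  refine ⟨closure (primitiveLM '' Metric.ball 0 1), ?_,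
    Filter.mem_of_superset (Metric.ball_mem_nhds 0 one_pos)
      fun g hg => subset_closure ⟨g, hg, rfl⟩⟩
  refine BoundedContinuousFunction.arzela_ascoli (Metric.closedBall 0 2)
    (isCompact_closedBall 0 2) _ ?_
    (Metric.equicontinuous_of_continuity_modulus (fun r => √r) ?_ _ ?_)
  · rintro _ t ⟨g, hg, rfl⟩
    rw [mem_ball_zero_iff] at hg
    rw [mem_closedBall_zero_iff]
    exact (norm_primitive_le g t.2).trans (by linarith)
  · simpa using Real.continuous_sqrt.tendsto 0
  · rintro s t ⟨_, g, hg, rfl⟩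
    rw [mem_ball_zero_iff] at hg
    exact (dist_primitive_le g s t).trans (mul_le_of_le_one_right (Real.sqrt_nonneg _) hg.le)

/-- `primitiveLM` as a bounded operator. -/
def primitiveCLM : L2 →L[ℂ] BoundedContinuousFunction (Set.Icc (-1 : ℝ) 1) C2 :=
  ContinuousLinearMap.mkOfIsCompactOperator isCompactOperator_primitiveLM

/-- The retraction of the line onto `[-1,1]`. -/
def clamp : C(ℝ, Set.Icc (-1 : ℝ) 1) := ⟨Set.projIcc (-1) 1 (by norm_num), continuous_projIcc⟩

/-- The inclusion of the continuous functions on `[-1,1]` into `L²`; a function is first extended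
to the line by constants. -/
def iccToL2 : BoundedContinuousFunction (Set.Icc (-1 : ℝ) 1) C2 →L[ℂ] L2 where
  toFun u := BoundedContinuousFunction.toLp 2 vol ℂ (u.compContinuous clamp)
  map_add' u v := map_add (BoundedContinuousFunction.toLp 2 vol ℂ) (u.compContinuous clamp)
    (v.compContinuous clamp)
  map_smul' c u := map_smul (BoundedContinuousFunction.toLp 2 vol ℂ) c (u.compContinuous clamp)
  cont := (ContinuousLinearMap.continuous _).comp
    (BoundedContinuousFunction.continuous_compContinuous _)

theorem coeFn_iccToL2_primitiveCLM (g : L2) :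
    iccToL2 (primitiveCLM g) =ᵐ[vol] primitive vol g := by
  filter_upwards [BoundedContinuousFunction.coeFn_toLp 2 vol ℂ ((primitiveCLM g).compContinuous
    clamp), ae_restrict_mem measurableSet_Ioo] with t hcoe ht
  refine hcoe.trans ?_
  change primitive vol g (Set.projIcc (-1 : ℝ) 1 (by norm_num) t) = _
  rw [Set.projIcc_of_mem _ (Set.Ioo_subset_Icc_self ht)]

/-- The inverse of the transverse operator for `δ = 0`: it maps `y` to the primitive `f` of
`h = i (σ · x) y` with `f(-1) = -(1 - J)/2 ∫ h`, where `J = swapMat x`. -/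
def inverseZero (x : EuclideanSpace ℝ (Fin 2)) : L2 →L[ℂ] L2 :=
  (iccToL2 - Lp.constL 2 vol ℂ ∘L matCLM ((1 / 2 : ℂ) • (1 - swapMat x)) ∘L
      BoundedContinuousFunction.evalCLM ℂ ⟨1, by simp⟩) ∘L
    primitiveCLM ∘L (Complex.I • matMul (pauliDot x))

theorem isCompactOperator_inverseZero (x : EuclideanSpace ℝ (Fin 2)) :
    IsCompactOperator (inverseZero x) := by
  have hcompact : IsCompactOperator primitiveCLM := isCompactOperator_primitiveLM
  exact (hcompact.comp_clm (Complex.I • matMul (pauliDot x))).clm_comp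
    (iccToL2 - Lp.constL 2 vol ℂ ∘L matCLM ((1 / 2 : ℂ) • (1 - swapMat x)) ∘L
      BoundedContinuousFunction.evalCLM ℂ ⟨1, by simp⟩)

section

variable {x : EuclideanSpace ℝ (Fin 2)}

theorem boundaryCond_primitive (hx : ‖x‖ = 1) (h : ℝ → C2) : BoundaryCond x fun t =>
    -matCLM ((1 / 2 : ℂ) • (1 - swapMat x)) (primitive vol h 1) + primitive vol h t := by
  set J := matCLM (swapMat x) with hJ
  have hJJ (v : C2) : J (J v) = v := by
    rw [hJ, ← matCLM_mul_apply, swapMat_mul_self hx, matCLM, map_one, one_apply_eq_self]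
  have hP (v : C2) : matCLM ((1 / 2 : ℂ) • (1 - swapMat x)) v = (1 / 2 : ℂ) • (v - J v) := by
    simp [hJ]
  simp only [hP]
  refine (boundaryCond_iff hx).2 ⟨?_, ?_⟩ <;>
    simp only [← hJ, primitive_vol_neg_one, map_smul, map_sub, map_neg, map_add, map_zero, hJJ] <;>
    module

theorem inverseZero_spec (hx : ‖x‖ = 1) (y : L2) :
    inverseZero x y ∈ transverseDomain x ∧
      HasWeakDeriv (inverseZero x y) (Complex.I • matMul (pauliDot x) y) := by
  set h : L2 := Complex.I • matMul (pauliDot x) y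
  set c : C2 := matCLM ((1 / 2 : ℂ) • (1 - swapMat x)) (primitive vol h 1)
  have hae : inverseZero x y =ᵐ[vol] fun t => -c + primitive vol h t := by
    have hval : inverseZero x y = iccToL2 (primitiveCLM h) - Lp.const 2 vol c := rfl
    rw [hval]
    filter_upwards [Lp.coeFn_sub (iccToL2 (primitiveCLM h)) (Lp.const 2 vol c),
      coeFn_iccToL2_primitiveCLM h, Lp.coeFn_const 2 vol c] with t hsub hprim hconst
    rw [hsub, Pi.sub_apply, hprim, hconst, Function.const_apply, sub_eq_neg_add]
  have hweak := hasWeakDeriv_iff_exists_ae_eq.2 ⟨-c, hae⟩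
  exact ⟨⟨⟨h, hweak⟩, _, isContRep_of_ae_eq hae, boundaryCond_primitive hx h⟩, hweak⟩

theorem exists_isResolvent_zero (hx : ‖x‖ = 1) {δ : ℝ} (hδ : 0 ≤ δ) :
    ∃ R : L2 →L[ℂ] L2, IsResolvent (transverseOp x δ) 0 R ∧ IsCompactOperator R := by
  refine exists_isResolvent_zero_of_parametrix (fun f => transverseOp_injective hx hδ)
    (isCompactOperator_inverseZero x) ((δ : ℂ) • matMul pauli3) fun y => ?_
  obtain ⟨hmem, hweak⟩ := inverseZero_spec hx y
  refine ⟨hmem, (transverseOp_mk δ hmem hweak).trans ?_⟩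
  rw [map_smul, ← matMul_mul, pauliDot_mul_self hx, matMul_one, smul_smul, neg_mul, Complex.I_mul_I,
    neg_neg, one_smul, smul_apply]

theorem isSelfAdjoint_transverseOp (hx : ‖x‖ = 1) {δ : ℝ} (hδ : 0 ≤ δ) :
    IsSelfAdjoint (transverseOp x δ) := by
  obtain ⟨R, hR, -⟩ := exists_isResolvent_zero hx hδ
  exact isSelfAdjoint_of_isResolvent_zero hR (inner_transverseOp hx δ)

theorem hasCompactResolvent_transverseOp (hx : ‖x‖ = 1) {δ : ℝ} (hδ : 0 ≤ δ) :
    HasCompactResolvent (transverseOp x δ) := by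
  obtain ⟨R, hR, hcompact⟩ := exists_isResolvent_zero hx hδ
  exact hasCompactResolvent_of_isResolvent hR hcompact

end

/-! ### Symmetries of the spectrum -/

theorem intertwines_matMul {x y : EuclideanSpace ℝ (Fin 2)} (hx : ‖x‖ = 1) (hy : ‖y‖ = 1) (δ : ℝ)
    {A : Matrix (Fin 2) (Fin 2) ℂ} {s : ℂ} (hdot : pauliDot y * A = s • (A * pauliDot x))
    (hpauli3 : pauli3 * A = s • (A * pauli3)) (hswap : swapMat y * A = A * swapMat x) :
    Intertwines (transverseOp x δ) (transverseOp y δ) s (matMul A) := fun f => by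
  have hf := hasWeakDeriv_domDeriv (x := x) f
  obtain ⟨u, hu⟩ := hf.exists_isContRep
  obtain ⟨hu1, hu2⟩ := (boundaryCond_iff hx).1 (boundaryCond_of_mem f.2 hu)
  have hmem : matMul A f ∈ transverseDomain y := by
    refine ⟨⟨_, hf.matMul A⟩, _, hu.matMul A, (boundaryCond_iff hy).2 ⟨?_, ?_⟩⟩
    · rw [← matCLM_mul_apply, hswap, matCLM_mul_apply, hu1]
    · rw [← matCLM_mul_apply, hswap, matCLM_mul_apply, hu2, map_neg]
  refine ⟨hmem, (transverseOp_mk δ hmem (hf.matMul A)).trans ?_⟩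
  rw [show transverseOp x δ f = _ from transverseOp_apply x δ f, map_add, map_smul, map_smul,
    ← matMul_mul, ← matMul_mul, hdot, hpauli3, matMul_smul, matMul_smul, matMul_mul, matMul_mul,
    smul_add, smul_comm s, smul_comm s]

theorem neg_mem_resolventSet {x : EuclideanSpace ℝ (Fin 2)} (hx : ‖x‖ = 1) (δ : ℝ) {z : ℂ}
    (h : z ∈ resolventSet (transverseOp x δ)) : -z ∈ resolventSet (transverseOp x δ) := by
  obtain ⟨R, hR⟩ := h
  have hJ : Intertwines (transverseOp x δ) (transverseOp x δ) (-1) (matMul (swapMat x)) :=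
    intertwines_matMul hx hx δ
      (by rw [pauliDot_mul_swapMat hx, swapMat_mul_pauliDot hx, neg_one_smul, neg_neg])
      (by rw [swapMat_mul_pauli3, neg_one_smul, neg_neg]) rfl
  rw [← neg_one_mul]
  exact ⟨_, hR.conj (by norm_num)
    (fun y => by rw [← matMul_mul, swapMat_mul_self hx, matMul_one]) hJ hJ⟩

/-- The matrix `diag(1, ω_y / ω_x)` with `ω_x = toC x`, which intertwines the operators for `x`
and `y`. -/
def rotMat (x y : EuclideanSpace ℝ (Fin 2)) : Matrix (Fin 2) (Fin 2) ℂ :=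
  !![1, 0; 0, toC y * (starRingEnd ℂ) (toC x)]

theorem rotMat_mul_rotMat {x y : EuclideanSpace ℝ (Fin 2)} (hx : ‖x‖ = 1) (hy : ‖y‖ = 1) :
    rotMat x y * rotMat y x = 1 := by
  ext i j
  fin_cases i <;> fin_cases j <;> simp [rotMat]
  linear_combination toC_mul_conj hy + toC y * (starRingEnd ℂ) (toC y) * toC_mul_conj hx

theorem intertwines_rotMat {x y : EuclideanSpace ℝ (Fin 2)} (hx : ‖x‖ = 1) (hy : ‖y‖ = 1)
    (δ : ℝ) : Intertwines (transverseOp x δ) (transverseOp y δ) 1 (matMul (rotMat x y)) := by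
  have hωx := toC_mul_conj hx
  have hωy := toC_mul_conj hy
  refine intertwines_matMul hx hy δ ?_ ?_ ?_
  · rw [pauliDot_eq, pauliDot_eq]
    ext i j
    fin_cases i <;> fin_cases j <;> simp [rotMat]
    · linear_combination (starRingEnd ℂ) (toC x) * hωy
    · linear_combination -toC y * hωx
  · ext i j
    fin_cases i <;> fin_cases j <;> simp [rotMat, pauli3]
  · ext i j
    fin_cases i <;> fin_cases j <;> simp [rotMat, swapMat]
    · linear_combination Complex.I * (starRingEnd ℂ) (toC x) * hωy
    · linear_combination -Complex.I * toC y * hωx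

theorem resolventSet_subset {x y : EuclideanSpace ℝ (Fin 2)} (hx : ‖x‖ = 1) (hy : ‖y‖ = 1)
    (δ : ℝ) : resolventSet (transverseOp x δ) ⊆ resolventSet (transverseOp y δ) := by
  rintro z ⟨R, hR⟩
  rw [← one_mul z]
  exact ⟨_, hR.conj (one_mul 1)
    (fun w => by rw [← matMul_mul, rotMat_mul_rotMat hx hy, matMul_one])
    (intertwines_rotMat hx hy δ) (intertwines_rotMat hy hx δ)⟩

theorem spectrum_eq {x y : EuclideanSpace ℝ (Fin 2)} (hx : ‖x‖ = 1) (hy : ‖y‖ = 1) (δ : ℝ) :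
    spectrum (transverseOp x δ) = spectrum (transverseOp y δ) :=
  congrArg compl ((resolventSet_subset hx hy δ).antisymm (resolventSet_subset hy hx δ))

theorem mem_spectrum_iff_neg_mem {x : EuclideanSpace ℝ (Fin 2)} (hx : ‖x‖ = 1) (δ : ℝ) (z : ℂ) :
    z ∈ spectrum (transverseOp x δ) ↔ -z ∈ spectrum (transverseOp x δ) := by
  refine not_congr ⟨neg_mem_resolventSet hx δ, fun h => ?_⟩
  simpa using neg_mem_resolventSet hx δ h

/-! ### The secular equation -/

/-- The wave number `(2j - 1)π / 4` of the `j`-th positive eigenvalue at `δ = 0`. -/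
def freeWaveNumber (j : ℕ) : ℝ := (2 * j - 1) * Real.pi / 4

theorem freeWaveNumber_strictMono : StrictMono freeWaveNumber := by
  intro i j hij
  have hij' : (i : ℝ) < j := by exact_mod_cast hij
  have := Real.pi_pos
  rw [freeWaveNumber, freeWaveNumber]
  gcongr

theorem half_lt_freeWaveNumber {j : ℕ} (hj : 1 ≤ j) : 1 / 2 < freeWaveNumber j := by
  refine lt_of_lt_of_le ?_ (freeWaveNumber_strictMono.monotone hj)
  have := Real.pi_gt_three
  rw [freeWaveNumber]
  push_cast
  linarith

theorem freeWaveNumber_pos {j : ℕ} (hj : 1 ≤ j) : 0 < freeWaveNumber j := by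
  linarith [half_lt_freeWaveNumber hj]

theorem strictMonoOn_phase {δ : ℝ} (hδ : 0 ≤ δ) :
    StrictMonoOn (fun k : ℝ => 2 * k - Real.arctan (δ / k)) (Set.Ioi 0) := by
  intro a ha b _ hab
  have hdiv : δ / b ≤ δ / a := div_le_div_of_nonneg_left hδ ha hab.le
  have := Real.arctan_strictMono.monotone hdiv
  dsimp only
  linarith

theorem exists_phase_eq {δ c : ℝ} (hδ : 0 ≤ δ) (hc : 0 < c) :
    ∃ k : ℝ, 0 < k ∧ 2 * k - Real.arctan (δ / k) = 2 * c := by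
  set b : ℝ := c + Real.pi / 4 with hb
  have hcb : c ≤ b := by linarith [Real.pi_pos]
  have hcont : ContinuousOn (fun k : ℝ => 2 * k - Real.arctan (δ / k)) (Set.Icc c b) :=
    (continuousOn_const.mul continuousOn_id).sub <| Real.continuous_arctan.comp_continuousOn <|
      continuousOn_const.div continuousOn_id fun k hk => (hc.trans_le hk.1).ne'
  have hlow : 2 * c - Real.arctan (δ / c) ≤ 2 * c := by
    linarith [Real.arctan_nonneg.2 (div_nonneg hδ hc.le)]
  have hhigh : 2 * c ≤ 2 * b - Real.arctan (δ / b) := by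
    linarith [Real.arctan_lt_pi_div_two (δ / b)]
  obtain ⟨k, hk, hphase⟩ := intermediate_value_Icc hcb hcont ⟨hlow, hhigh⟩
  exact ⟨k, hc.trans_le hk.1, hphase⟩

/-- The `j`-th positive solution `k` of the secular equation `k cos 2k + δ sin 2k = 0`, for
`δ ≥ 0` and `j ≥ 1` (and `0` for other values of the parameters). -/
def waveNumber (δ : ℝ) (j : ℕ) : ℝ :=
  if h : 0 ≤ δ ∧ 1 ≤ j then (exists_phase_eq h.1 (freeWaveNumber_pos h.2)).choose else 0

section

variable {δ : ℝ} {j : ℕ}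

theorem waveNumber_spec (hδ : 0 ≤ δ) (hj : 1 ≤ j) :
    0 < waveNumber δ j ∧
      2 * waveNumber δ j - Real.arctan (δ / waveNumber δ j) = 2 * freeWaveNumber j := by
  rw [waveNumber, dif_pos ⟨hδ, hj⟩]
  exact (exists_phase_eq hδ (freeWaveNumber_pos hj)).choose_spec

theorem waveNumber_pos (hδ : 0 ≤ δ) (hj : 1 ≤ j) : 0 < waveNumber δ j :=
  (waveNumber_spec hδ hj).1

theorem waveNumber_sub_freeWaveNumber (hδ : 0 ≤ δ) (hj : 1 ≤ j) :
    waveNumber δ j - freeWaveNumber j = Real.arctan (δ / waveNumber δ j) / 2 := by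
  linarith [(waveNumber_spec hδ hj).2]

theorem freeWaveNumber_le_waveNumber (hδ : 0 ≤ δ) (hj : 1 ≤ j) :
    freeWaveNumber j ≤ waveNumber δ j := by
  have := Real.arctan_nonneg.2 (div_nonneg hδ (waveNumber_pos hδ hj).le)
  linarith [waveNumber_sub_freeWaveNumber hδ hj]

theorem waveNumber_le (hδ : 0 ≤ δ) (hj : 1 ≤ j) : waveNumber δ j ≤ j * (Real.pi / 2) := by
  have hphase := waveNumber_sub_freeWaveNumber hδ hj
  have := Real.arctan_lt_pi_div_two (δ / waveNumber δ j)
  rw [freeWaveNumber] at hphase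
  linarith

theorem waveNumber_lt_waveNumber (hδ : 0 ≤ δ) {i : ℕ} (hi : 1 ≤ i) (hij : i < j) :
    waveNumber δ i < waveNumber δ j := by
  obtain ⟨hi_pos, hi_eq⟩ := waveNumber_spec hδ hi
  obtain ⟨hj_pos, hj_eq⟩ := waveNumber_spec hδ (hi.trans hij.le)
  rw [← (strictMonoOn_phase hδ).lt_iff_lt hi_pos hj_pos, hi_eq, hj_eq]
  linarith [freeWaveNumber_strictMono hij]

theorem cos_sub_arctan (y k : ℝ) :
    Real.cos (k - Real.arctan y) =
      Real.cos (Real.arctan y) * (Real.cos k + y * Real.sin k) := by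
  have hsin : Real.sin (Real.arctan y) = y * Real.cos (Real.arctan y) := by
    rw [← Real.tan_mul_cos (Real.cos_arctan_pos y).ne', Real.tan_arctan]
  rw [Real.cos_sub, hsin]
  ring

theorem secular_iff_cos_phase_eq_zero (y k : ℝ) :
    Real.cos k + y * Real.sin k = 0 ↔ Real.cos (k - Real.arctan y) = 0 := by
  rw [cos_sub_arctan, mul_eq_zero, or_iff_right (Real.cos_arctan_pos y).ne']

theorem cos_eq_zero_iff_exists_freeWaveNumber {y : ℝ} (hy : -(Real.pi / 2) < y) :
    Real.cos y = 0 ↔ ∃ j, 1 ≤ j ∧ y = 2 * freeWaveNumber j := by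
  have hpi := Real.pi_pos
  rw [Real.cos_eq_zero_iff]
  constructor
  · rintro ⟨n, rfl⟩
    have hn : (-1 : ℤ) < n := by
      have : (-1 : ℝ) < n := by
        by_contra! hcon
        nlinarith
      exact_mod_cast this
    obtain ⟨m, rfl⟩ := Int.eq_ofNat_of_zero_le (show 0 ≤ n by lia)
    refine ⟨m + 1, by lia, ?_⟩
    rw [freeWaveNumber]
    push_cast
    ring
  · rintro ⟨j, -, rfl⟩
    refine ⟨(j : ℤ) - 1, ?_⟩
    rw [freeWaveNumber]
    push_cast
    ring

theorem secular_iff_exists_waveNumber_eq (hδ : 0 ≤ δ) {k : ℝ} (hk : 0 < k) :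
    Real.cos (2 * k) + δ / k * Real.sin (2 * k) = 0 ↔ ∃ j, 1 ≤ j ∧ waveNumber δ j = k := by
  have hphase : -(Real.pi / 2) < 2 * k - Real.arctan (δ / k) := by
    linarith [Real.arctan_lt_pi_div_two (δ / k)]
  rw [secular_iff_cos_phase_eq_zero, cos_eq_zero_iff_exists_freeWaveNumber hphase]
  refine exists_congr fun j => and_congr_right fun hj => ?_
  obtain ⟨hj_pos, hj_eq⟩ := waveNumber_spec hδ hj
  rw [← hj_eq, (strictMonoOn_phase hδ).eq_iff_eq hk hj_pos, eq_comm]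

/-- The `j`-th positive eigenvalue of the transverse operator, for `δ ≥ 0` and `j ≥ 1`. -/
def eigenvalueSeq (δ : ℝ) (j : ℕ) : ℝ := Real.sqrt (waveNumber δ j ^ 2 + δ ^ 2)

theorem eigenvalueSeq_sq (δ : ℝ) (j : ℕ) :
    eigenvalueSeq δ j ^ 2 = waveNumber δ j ^ 2 + δ ^ 2 :=
  Real.sq_sqrt (by positivity)

theorem eigenvalueSeq_pos (hδ : 0 ≤ δ) (hj : 1 ≤ j) : 0 < eigenvalueSeq δ j := by
  have := waveNumber_pos hδ hj
  exact Real.sqrt_pos.2 (by positivity)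

theorem strictMonoOn_eigenvalueSeq (hδ : 0 ≤ δ) :
    StrictMonoOn (eigenvalueSeq δ) (Set.Ici 1) := by
  intro i hi j _ hij
  have hlt := waveNumber_lt_waveNumber hδ hi hij
  have hpos := waveNumber_pos hδ hi
  exact Real.sqrt_lt_sqrt (by positivity) (by gcongr)

theorem eigenvalueSeq_eq_iff {μ k : ℝ} (hδ : 0 ≤ δ) (hμ : 0 < μ) (hk : 0 < k)
    (hkμ : k ^ 2 = μ ^ 2 - δ ^ 2) (hj : 1 ≤ j) :
    eigenvalueSeq δ j = μ ↔ waveNumber δ j = k := by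
  rw [← sq_eq_sq₀ (eigenvalueSeq_pos hδ hj).le hμ.le, ← sq_eq_sq₀ (waveNumber_pos hδ hj).le hk.le,
    eigenvalueSeq_sq, hkμ, eq_sub_iff_add_eq]

theorem eigenvalueSeq_bounds (hδ : 0 ≤ δ) (hj : 1 ≤ j) :
    (2 * (j : ℝ) - 1) ^ 2 * (Real.pi ^ 2 / 16) ≤ eigenvalueSeq δ j ^ 2 - δ ^ 2 ∧
      eigenvalueSeq δ j ^ 2 - δ ^ 2 ≤ (j : ℝ) ^ 2 * (Real.pi ^ 2 / 4) := by
  rw [eigenvalueSeq_sq, add_sub_cancel_right]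
  constructor
  · calc (2 * (j : ℝ) - 1) ^ 2 * (Real.pi ^ 2 / 16) = freeWaveNumber j ^ 2 := by
          rw [freeWaveNumber]; ring
      _ ≤ waveNumber δ j ^ 2 :=
          pow_le_pow_left₀ (freeWaveNumber_pos hj).le (freeWaveNumber_le_waveNumber hδ hj) 2
  · calc waveNumber δ j ^ 2 ≤ (j * (Real.pi / 2)) ^ 2 :=
          pow_le_pow_left₀ (waveNumber_pos hδ hj).le (waveNumber_le hδ hj) 2
      _ = (j : ℝ) ^ 2 * (Real.pi ^ 2 / 4) := by ring

end

/-! ### Asymptotics of the eigenvalues -/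

theorem arctan_le_self {y : ℝ} (hy : 0 ≤ y) : Real.arctan y ≤ y := by
  have hmono : MonotoneOn (fun y : ℝ => y - Real.arctan y) (Set.Ici 0) := by
    refine monotoneOn_of_deriv_nonneg (convex_Ici 0) (by fun_prop)
      (differentiable_id.sub Real.differentiable_arctan).differentiableOn fun t _ => ?_
    have hderiv : HasDerivAt (fun y : ℝ => y - Real.arctan y) (1 - 1 / (1 + t ^ 2)) t :=
      (hasDerivAt_id t).sub (Real.hasDerivAt_arctan t)
    rw [hderiv.deriv, sub_nonneg, div_le_one (by positivity)]
    nlinarith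
  simpa using hmono Set.self_mem_Ici hy hy

theorem self_sub_cube_le_arctan {y : ℝ} (hy : 0 ≤ y) : y - y ^ 3 ≤ Real.arctan y := by
  have hmono : MonotoneOn (fun y : ℝ => Real.arctan y - (y - y ^ 3)) (Set.Ici 0) := by
    refine monotoneOn_of_deriv_nonneg (convex_Ici 0) (by fun_prop) (Real.differentiable_arctan.sub
      (differentiable_id.sub (differentiable_pow 3))).differentiableOn fun t _ => ?_
    have hderiv : HasDerivAt (fun y : ℝ => Real.arctan y - (y - y ^ 3))
        (1 / (1 + t ^ 2) - (1 - 3 * t ^ 2)) t :=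
      (Real.hasDerivAt_arctan t).sub ((hasDerivAt_id t).sub (hasDerivAt_pow 3 t))
    have hrewrite : 1 / (1 + t ^ 2) - (1 - 3 * t ^ 2) = (2 * t ^ 2 + 3 * t ^ 4) / (1 + t ^ 2) := by
      field_simp
      ring
    rw [hderiv.deriv, hrewrite]
    positivity
  simpa using hmono Set.self_mem_Ici hy hy

theorem abs_arctan_sub_self_le {y : ℝ} (hy : 0 ≤ y) : |Real.arctan y - y| ≤ y ^ 3 := by
  rw [abs_sub_comm, abs_of_nonneg (sub_nonneg.2 (arctan_le_self hy))]
  linarith [self_sub_cube_le_arctan hy]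

theorem waveNumber_sub_freeWaveNumber_le {δ : ℝ} (hδ : 0 ≤ δ) {j : ℕ} (hj : 1 ≤ j) :
    waveNumber δ j - freeWaveNumber j ≤ δ := by
  have hpos := waveNumber_pos hδ hj
  have hhalf := (half_lt_freeWaveNumber hj).le.trans (freeWaveNumber_le_waveNumber hδ hj)
  calc waveNumber δ j - freeWaveNumber j = Real.arctan (δ / waveNumber δ j) / 2 :=
        waveNumber_sub_freeWaveNumber hδ hj
    _ ≤ δ / waveNumber δ j / 2 := by gcongr; exact arctan_le_self (by positivity)
    _ ≤ δ / (1 / 2) / 2 := by gcongr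
    _ = δ := by ring

theorem abs_mul_waveNumber_sub_le {δ : ℝ} (hδ : 0 ≤ δ) {j : ℕ} (hj : 1 ≤ j) :
    |waveNumber δ j * (waveNumber δ j - freeWaveNumber j) - δ / 2| ≤ 2 * δ ^ 3 := by
  have hhalf := (half_lt_freeWaveNumber hj).le.trans (freeWaveNumber_le_waveNumber hδ hj)
  rw [waveNumber_sub_freeWaveNumber hδ hj]
  have hpos := waveNumber_pos hδ hj
  set k := waveNumber δ j
  have hfactor : k * (Real.arctan (δ / k) / 2) - δ / 2 =
      k / 2 * (Real.arctan (δ / k) - δ / k) := by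
    field_simp
  calc |k * (Real.arctan (δ / k) / 2) - δ / 2|
      = k / 2 * |Real.arctan (δ / k) - δ / k| := by
        rw [hfactor, abs_mul, abs_of_pos (half_pos hpos)]
    _ ≤ k / 2 * (δ / k) ^ 3 := by gcongr; exact abs_arctan_sub_self_le (by positivity)
    _ = δ ^ 3 / (2 * k ^ 2) := by field_simp
    _ ≤ δ ^ 3 / (2 * (1 / 2) ^ 2) := by gcongr
    _ = 2 * δ ^ 3 := by ring

section

open Asymptotics Filter Topology

variable {l : Filter ℝ} {k : ℝ → ℝ} {c : ℝ}

theorem isBigO_inv_of_eventually_le (hc : 0 < c) (hk : ∀ᶠ δ in l, c ≤ k δ) :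
    (fun δ => (k δ)⁻¹) =O[l] fun _ => (1 : ℝ) := by
  refine IsBigO.of_bound c⁻¹ ?_
  filter_upwards [hk] with δ hδ
  rw [norm_inv, Real.norm_of_nonneg (hc.le.trans hδ), norm_one, mul_one]
  exact inv_anti₀ hc hδ

theorem isBigO_sub_add_div_of_mul_sub (hc : 0 < c) (hl : l ≤ 𝓝 0) (hk : ∀ᶠ δ in l, c ≤ k δ)
    (hkc : (fun δ => k δ - c) =O[l] fun δ => δ)
    (h : (fun δ => k δ * (k δ - c) - δ / 2) =O[l] fun δ => δ ^ 3) :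
    (fun δ => k δ - (c + δ / (2 * c))) =O[l] fun δ => δ ^ 2 := by
  have hinv := isBigO_inv_of_eventually_le hc hk
  have hcube : (fun δ : ℝ => δ ^ 3) =O[l] fun δ => δ ^ 2 :=
    (isLittleO_pow_pow (by norm_num)).isBigO.mono hl
  have hmain : (fun δ => (k δ * (k δ - c) - δ / 2) * (k δ)⁻¹ -
      1 / (2 * c) * (δ * (k δ - c) * (k δ)⁻¹)) =O[l] fun δ => δ ^ 2 := by
    refine IsBigO.sub (by simpa using (h.trans hcube).mul hinv) (IsBigO.const_mul_left ?_ _)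
    simpa [pow_two] using ((isBigO_refl (fun δ : ℝ => δ) l).mul hkc).mul hinv
  refine hmain.congr' ?_ EventuallyEq.rfl
  filter_upwards [hk] with δ hδ
  have hne : k δ ≠ 0 := (hc.trans_le hδ).ne'
  field_simp
  ring

/-- Each step divides `k (k - c) = δ / 2 + O(δ³)` by `k` and inserts the expansion of `k` obtained
so far. -/
theorem isBigO_sub_quadratic_of_mul_sub (hc : 0 < c) (hl : l ≤ 𝓝 0) (hk : ∀ᶠ δ in l, c ≤ k δ)
    (hkc : (fun δ => k δ - c) =O[l] fun δ => δ)
    (h : (fun δ => k δ * (k δ - c) - δ / 2) =O[l] fun δ => δ ^ 3) :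
    (fun δ => k δ - (c + δ / (2 * c) - δ ^ 2 / (4 * c ^ 3))) =O[l] fun δ => δ ^ 3 := by
  have hinv := isBigO_inv_of_eventually_le hc hk
  have hlin := isBigO_sub_add_div_of_mul_sub hc hl hk hkc h
  have hid := isBigO_refl (fun δ : ℝ => δ) l
  have hmain : (fun δ => (k δ * (k δ - c) - δ / 2) * (k δ)⁻¹ -
      1 / (2 * c) * (δ * ((k δ - (c + δ / (2 * c))) * (k δ)⁻¹)) +
      1 / (4 * c ^ 3) * (δ * δ * ((k δ - c) * (k δ)⁻¹))) =O[l] fun δ => δ ^ 3 := by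
    refine IsBigO.add (IsBigO.sub (by simpa using h.mul hinv) ?_) ?_ <;>
      refine IsBigO.const_mul_left ?_ _
    · exact (hid.mul (hlin.mul hinv)).congr_right fun δ => by ring
    · exact ((hid.mul hid).mul (hkc.mul hinv)).congr_right fun δ => by ring
  refine hmain.congr' ?_ EventuallyEq.rfl
  filter_upwards [hk] with δ hδ
  have hne : k δ ≠ 0 := (hc.trans_le hδ).ne'
  field_simp
  ring

theorem isBigO_sqrt_sq_add_sq_sub (hc : 0 < c) (hk : ∀ᶠ δ in l, c ≤ k δ)
    (hkc : (fun δ => k δ - c) =O[l] fun δ => δ) :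
    (fun δ => √(k δ ^ 2 + δ ^ 2) - k δ - δ ^ 2 / (2 * c)) =O[l] fun δ => δ ^ 3 := by
  have hle : ∀ᶠ δ in l, k δ ≤ √(k δ ^ 2 + δ ^ 2) := by
    filter_upwards with δ
    exact Real.le_sqrt_of_sq_le (by linarith [sq_nonneg δ])
  have hdiff : (fun δ => √(k δ ^ 2 + δ ^ 2) - k δ) =O[l] fun δ => δ := by
    refine IsBigO.of_bound 1 ?_
    filter_upwards [hk, hle] with δ hkδ hleδ
    have hkpos := hc.trans_le hkδ
    rw [Real.norm_of_nonneg (sub_nonneg.2 hleδ), one_mul, Real.norm_eq_abs, sub_le_iff_le_add]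
    refine Real.sqrt_le_iff.2 ⟨by positivity, ?_⟩
    nlinarith [sq_abs δ, mul_nonneg (abs_nonneg δ) hkpos.le]
  have hinv : (fun δ => (√(k δ ^ 2 + δ ^ 2) + k δ)⁻¹) =O[l] fun _ => (1 : ℝ) := by
    refine isBigO_inv_of_eventually_le hc ?_
    filter_upwards [hk] with δ hδ
    linarith [Real.sqrt_nonneg (k δ ^ 2 + δ ^ 2)]
  have hid := isBigO_refl (fun δ : ℝ => δ) l
  have hmain : (fun δ => -1 / (2 * c) * (δ * δ * (((√(k δ ^ 2 + δ ^ 2) - k δ) + 2 * (k δ - c)) *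
      (√(k δ ^ 2 + δ ^ 2) + k δ)⁻¹))) =O[l] fun δ => δ ^ 3 :=
    (((hid.mul hid).mul ((hdiff.add (hkc.const_mul_left 2)).mul hinv)).congr_right
      fun δ => by ring).const_mul_left _
  refine hmain.congr' ?_ EventuallyEq.rfl
  filter_upwards [hk] with δ hδ
  have hsq : √(k δ ^ 2 + δ ^ 2) ^ 2 = k δ ^ 2 + δ ^ 2 := Real.sq_sqrt (by positivity)
  have hne : √(k δ ^ 2 + δ ^ 2) + k δ ≠ 0 := by
    have := hc.trans_le hδ
    positivity
  field_simp
  linear_combination (-2 * c) * hsq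

theorem isBigO_eigenvalueSeq_sub {j : ℕ} (hj : 1 ≤ j) :
    (fun δ : ℝ => eigenvalueSeq δ j -
      ((2 * (j : ℝ) - 1) * Real.pi / 4 + 2 / ((2 * (j : ℝ) - 1) * Real.pi) * δ +
        (-16 / ((2 * (j : ℝ) - 1) ^ 3 * Real.pi ^ 3) +
          2 / ((2 * (j : ℝ) - 1) * Real.pi)) * δ ^ 2))
      =O[𝓝[≥] 0] fun δ : ℝ => δ ^ 3 := by
  have hc := freeWaveNumber_pos hj
  have hnonneg : ∀ᶠ δ : ℝ in 𝓝[≥] 0, 0 ≤ δ := eventually_mem_nhdsWithin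
  have hk : ∀ᶠ δ in 𝓝[≥] 0, freeWaveNumber j ≤ waveNumber δ j :=
    hnonneg.mono fun δ hδ => freeWaveNumber_le_waveNumber hδ hj
  have hkc : (fun δ => waveNumber δ j - freeWaveNumber j) =O[𝓝[≥] 0] fun δ => δ := by
    refine IsBigO.of_bound 1 ?_
    filter_upwards [hnonneg, hk] with δ hδ hkδ
    rw [Real.norm_of_nonneg (sub_nonneg.2 hkδ), Real.norm_of_nonneg hδ, one_mul]
    exact waveNumber_sub_freeWaveNumber_le hδ hj
  have hmul : (fun δ => waveNumber δ j * (waveNumber δ j - freeWaveNumber j) - δ / 2)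
      =O[𝓝[≥] 0] fun δ => δ ^ 3 := by
    refine IsBigO.of_bound 2 ?_
    filter_upwards [hnonneg] with δ hδ
    rw [Real.norm_eq_abs, Real.norm_of_nonneg (pow_nonneg hδ 3)]
    exact abs_mul_waveNumber_sub_le hδ hj
  refine ((isBigO_sub_quadratic_of_mul_sub hc nhdsWithin_le_nhds hk hkc hmul).add
    (isBigO_sqrt_sq_add_sq_sub hc hk hkc)).congr_left fun δ => ?_
  have hj_ne : 2 * (j : ℝ) - 1 ≠ 0 := by
    rintro hzero
    simp [freeWaveNumber, hzero] at hc
  have hpi := Real.pi_ne_zero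
  rw [eigenvalueSeq, freeWaveNumber]
  field_simp
  ring

end

/-! ### The eigenvalue equation as a linear system -/

section

variable {x : EuclideanSpace ℝ (Fin 2)}

/-- The coefficient matrix `i z (σ · x) - δ (i (σ · x) σ₃)` of the linear system `f' = M f` which
is equivalent to the eigenvalue equation `-i (σ · x) f' + δ σ₃ f = z f`. -/
def genMat (x : EuclideanSpace ℝ (Fin 2)) (δ : ℝ) (z : ℂ) : Matrix (Fin 2) (Fin 2) ℂ :=
  (Complex.I * z) • pauliDot x - (δ : ℂ) • swapMat x

theorem matMul_sub (A B : Matrix (Fin 2) (Fin 2) ℂ) (f : L2) :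
    matMul (A - B) f = matMul A f - matMul B f := by
  refine Lp.ext ?_
  filter_upwards [coeFn_matMul (A - B) f, coeFn_matMul A f, coeFn_matMul B f,
    Lp.coeFn_sub (matMul A f) (matMul B f)] with t hAB hA hB hsub
  rw [hAB, hsub, Pi.sub_apply, hA, hB, matCLM, map_sub, sub_apply]

theorem matMul_genMat (x : EuclideanSpace ℝ (Fin 2)) (δ : ℝ) (z : ℂ) (f : L2) :
    matMul (genMat x δ z) f =
      Complex.I • matMul (pauliDot x) (z • f - (δ : ℂ) • matMul pauli3 f) := by
  rw [genMat, matMul_sub, matMul_smul, matMul_smul, swapMat_eq, matMul_smul, matMul_mul, map_sub,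
    map_smul, map_smul]
  module

theorem neg_I_smul_pauliDot_eq_iff (hx : ‖x‖ = 1) (g h : L2) :
    (-Complex.I) • matMul (pauliDot x) g = h ↔ g = Complex.I • matMul (pauliDot x) h := by
  constructor <;> rintro rfl <;>
    rw [map_smul, ← matMul_mul, pauliDot_mul_self hx, matMul_one, smul_smul] <;> simp

theorem mem_eigenspace_iff (hx : ‖x‖ = 1) (δ : ℝ) (z : ℂ) (f : L2) :
    f ∈ eigenspace (transverseOp x δ) z ↔
      f ∈ transverseDomain x ∧ HasWeakDeriv f (matMul (genMat x δ z) f) := by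
  constructor
  · rintro ⟨hf, heq⟩
    refine ⟨hf, ?_⟩
    have hderiv := (transverseOp_apply x δ ⟨f, hf⟩).symm.trans heq
    rw [← eq_sub_iff_add_eq, neg_I_smul_pauliDot_eq_iff hx, ← matMul_genMat] at hderiv
    rw [← hderiv]
    exact hasWeakDeriv_domDeriv ⟨f, hf⟩
  · rintro ⟨hf, hderiv⟩
    refine ⟨hf, ?_⟩
    rw [transverseOp_mk δ hf hderiv, ← eq_sub_iff_add_eq, neg_I_smul_pauliDot_eq_iff hx,
      ← matMul_genMat]

theorem sq_lt_sq_of_mem_eigenspace (hx : ‖x‖ = 1) {δ μ : ℝ} (hδ : 0 ≤ δ) {f : L2}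
    (hf : f ∈ eigenspace (transverseOp x δ) (μ : ℂ)) (hf0 : f ≠ 0) : δ ^ 2 < μ ^ 2 := by
  obtain ⟨hdom, heq⟩ := hf
  obtain ⟨u, hu⟩ := (hasWeakDeriv_domDeriv ⟨f, hdom⟩).exists_isContRep
  have hnorm := norm_sq_transverseOp hx δ ⟨f, hdom⟩ hu
  have hTf : ‖transverseOp x δ ⟨f, hdom⟩‖ ^ 2 = μ ^ 2 * ‖f‖ ^ 2 := by
    rw [heq, norm_smul, mul_pow, Complex.norm_real, Real.norm_eq_abs, sq_abs]
  have hderiv : 0 < ‖domDeriv x ⟨f, hdom⟩‖ ^ 2 := by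
    have : domDeriv x ⟨f, hdom⟩ ≠ 0 := fun hzero =>
      hf0 (congrArg Subtype.val (eq_zero_of_domDeriv_eq_zero hx hzero))
    positivity
  have hboundary : 0 ≤ δ * (‖u 1‖ ^ 2 + ‖u (-1)‖ ^ 2) := by positivity
  have hmul : δ ^ 2 * ‖f‖ ^ 2 < μ ^ 2 * ‖f‖ ^ 2 := by
    linarith [hTf.symm.trans hnorm]
  exact lt_of_mul_lt_mul_right hmul (sq_nonneg _)

end

theorem eqOn_Icc_of_eq_add_integral {E : Type*} [NormedAddCommGroup E] [NormedSpace ℝ E]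
    [CompleteSpace E] {v : E → E} {K : NNReal} (hv : LipschitzWith K v) {a b : ℝ} {u e : ℝ → E}
    (hu : ContinuousOn u (Set.Icc a b))
    (hint : ∀ t ∈ Set.Icc a b, u t = u a + ∫ s in a..t, v (u s))
    (he : ∀ t, HasDerivAt e (v (e t)) t) (ha : u a = e a) : Set.EqOn u e (Set.Icc a b) := by
  have hvu : ContinuousOn (fun t => v (u t)) (Set.Icc a b) := hv.continuous.comp_continuousOn hu
  refine ODE_solution_unique_of_mem_Icc_right (v := fun _ => v) (s := fun _ => Set.univ) (K := K)
    (fun _ _ => hv.lipschitzOnWith) hu (fun t ht => ?_) (fun _ _ => Set.mem_univ _)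
    (fun t _ => (he t).continuousAt.continuousWithinAt) (fun t _ => (he t).hasDerivWithinAt)
    (fun _ _ => Set.mem_univ _) ha
  have ht' : t ∈ Set.Icc a b := Set.Ico_subset_Icc_self ht
  have := Fact.mk ht'
  have hderiv : HasDerivWithinAt (fun t => u a + ∫ s in a..t, v (u s)) (v (u t))
      (Set.Icc a b) t :=
    (intervalIntegral.integral_hasDerivWithinAt_right
      ((hvu.mono (Set.Icc_subset_Icc_right ht'.2)).intervalIntegrable_of_Icc ht'.1)
      (hvu.stronglyMeasurableAtFilter_nhdsWithin measurableSet_Icc t) (hvu t ht')).const_add _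
  exact (hderiv.congr hint (hint t ht')).mono_of_mem_nhdsWithin (Icc_mem_nhdsGE_of_mem ht)

theorem HasWeakDeriv.eqOn_of_linear_ode {A : Matrix (Fin 2) (Fin 2) ℂ} {f : L2}
    (hf : HasWeakDeriv f (TransverseDirac.matMul A f)) {u e : ℝ → C2} (hu : IsContRep f u)
    (he : ∀ t, HasDerivAt e (matCLM A (e t)) t) (h : u (-1) = e (-1)) :
    Set.EqOn u e (Set.Icc (-1) 1) := by
  refine eqOn_Icc_of_eq_add_integral (matCLM A).lipschitz hu.1 (fun t ht => ?_) he h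
  rw [hf.eq_add_primitive hu ht, ← primitive_vol_eq_intervalIntegral _ ht]
  exact congrArg _ (integral_congr_ae (ae_restrict_of_ae (hu.matMul A).2))

/-! ### The eigenfunctions -/

/-- The vector `(1, -i (x₁ + i x₂))`, which spans the boundary values admitted at `-1`. -/
def vMinus (x : EuclideanSpace ℝ (Fin 2)) : C2 := !₂[(1 : ℂ), -(Complex.I * toC x)]

/-- The vector `(1, i (x₁ + i x₂))`, which spans the boundary values admitted at `1`. -/
def vPlus (x : EuclideanSpace ℝ (Fin 2)) : C2 := !₂[(1 : ℂ), Complex.I * toC x]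

section

variable {x : EuclideanSpace ℝ (Fin 2)}

theorem pauli3_vMinus (x : EuclideanSpace ℝ (Fin 2)) : matCLM pauli3 (vMinus x) = vPlus x := by
  ext i
  fin_cases i
  · simp [pauli3, vMinus, vPlus]
  · simp [pauli3, vMinus, vPlus]

theorem pauli3_vPlus (x : EuclideanSpace ℝ (Fin 2)) : matCLM pauli3 (vPlus x) = vMinus x := by
  rw [← pauli3_vMinus, ← matCLM_mul_apply, pauli3_mul_self, matCLM, map_one, one_apply_eq_self]

theorem swapMat_vMinus (hx : ‖x‖ = 1) : matCLM (swapMat x) (vMinus x) = -vMinus x := by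
  rw [← neg_one_smul ℂ (vMinus x), matCLM_swapMat_eq_smul_iff hx (by norm_num)]
  simp [vMinus]

theorem swapMat_vPlus (hx : ‖x‖ = 1) : matCLM (swapMat x) (vPlus x) = vPlus x := by
  rw [← one_smul ℂ (vPlus x), map_smul, one_smul, matCLM_swapMat_eq_smul_iff hx (by norm_num)]
  simp [vPlus]

theorem pauliDot_vPlus (hx : ‖x‖ = 1) :
    matCLM (pauliDot x) (vPlus x) = Complex.I • vMinus x := by
  rw [← pauli3_vMinus, ← matCLM_mul_apply, pauliDot_mul_pauli3, matCLM, map_smul, smul_apply,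
    swapMat_vMinus hx]
  module

theorem pauliDot_vMinus (hx : ‖x‖ = 1) :
    matCLM (pauliDot x) (vMinus x) = (-Complex.I) • vPlus x := by
  rw [← pauli3_vPlus, ← matCLM_mul_apply, pauliDot_mul_pauli3, matCLM, map_smul, smul_apply,
    swapMat_vPlus hx]

theorem genMat_vMinus (hx : ‖x‖ = 1) (δ : ℝ) (z : ℂ) :
    matCLM (genMat x δ z) (vMinus x) = (δ : ℂ) • vMinus x + z • vPlus x := by
  have hI : Complex.I * z * -Complex.I = z := by linear_combination -z * Complex.I_mul_I
  rw [genMat, matCLM, map_sub, map_smul, map_smul, sub_apply, smul_apply, smul_apply,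
    pauliDot_vMinus hx, swapMat_vMinus hx, smul_smul, hI]
  module

theorem genMat_vPlus (hx : ‖x‖ = 1) (δ : ℝ) (z : ℂ) :
    matCLM (genMat x δ z) (vPlus x) = -z • vMinus x - (δ : ℂ) • vPlus x := by
  have hI : Complex.I * z * Complex.I = -z := by linear_combination z * Complex.I_mul_I
  rw [genMat, matCLM, map_sub, map_smul, map_smul, sub_apply, smul_apply, smul_apply,
    pauliDot_vPlus hx, swapMat_vPlus hx, smul_smul, hI]

/-- The solution of the eigenvalue equation for `μ` with value `vMinus x` at `-1`, where
`k² = μ² - δ²` and `k ≠ 0`. -/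
def eigenFun (x : EuclideanSpace ℝ (Fin 2)) (δ μ k : ℝ) (t : ℝ) : C2 :=
  ((Real.cos (k * (t + 1)) + δ / k * Real.sin (k * (t + 1)) : ℝ) : ℂ) • vMinus x +
    ((μ / k * Real.sin (k * (t + 1)) : ℝ) : ℂ) • vPlus x

theorem hasDerivAt_eigenFun (hx : ‖x‖ = 1) {δ μ k : ℝ} (hk : k ≠ 0)
    (hkμ : k ^ 2 = μ ^ 2 - δ ^ 2) (t : ℝ) :
    HasDerivAt (eigenFun x δ μ k) (matCLM (genMat x δ μ) (eigenFun x δ μ k t)) t := by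
  have harg : HasDerivAt (fun t : ℝ => k * (t + 1)) k t := by
    simpa using ((hasDerivAt_id t).add_const 1).const_mul k
  have hMinus :=
    (harg.cos.add (harg.sin.const_mul (δ / k))).ofReal_comp.smul_const (vMinus x)
  have hPlus := (harg.sin.const_mul (μ / k)).ofReal_comp.smul_const (vPlus x)
  refine (hMinus.add hPlus).congr_deriv ?_
  rw [eigenFun, map_add, map_smul, map_smul, genMat_vMinus hx, genMat_vPlus hx]
  have hk' : (k : ℂ) ≠ 0 := by exact_mod_cast hk
  have hkμ' : (k : ℂ) ^ 2 = μ ^ 2 - δ ^ 2 := by exact_mod_cast hkμ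
  match_scalars
  · field_simp
    linear_combination (-Complex.sin ((k : ℂ) * (t + 1))) * hkμ'
  · field_simp
    ring

theorem eigenFun_neg_one (x : EuclideanSpace ℝ (Fin 2)) (δ μ k : ℝ) :
    eigenFun x δ μ k (-1) = vMinus x := by
  simp [eigenFun]

theorem swapMat_eigenFun_one (hx : ‖x‖ = 1) (δ μ k : ℝ) :
    matCLM (swapMat x) (eigenFun x δ μ k 1) = eigenFun x δ μ k 1 -
      (2 : ℂ) • ((Real.cos (2 * k) + δ / k * Real.sin (2 * k) : ℝ) : ℂ) • vMinus x := by
  have harg : k * ((1 : ℝ) + 1) = 2 * k := by ring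
  rw [eigenFun, map_add, map_smul, map_smul, swapMat_vMinus hx, swapMat_vPlus hx, harg]
  module

theorem continuous_eigenFun (x : EuclideanSpace ℝ (Fin 2)) (δ μ k : ℝ) :
    Continuous (eigenFun x δ μ k) := by
  unfold eigenFun
  fun_prop

/-- The function `eigenFun` as an element of `L²`. -/
def eigenVec (x : EuclideanSpace ℝ (Fin 2)) (δ μ k : ℝ) : L2 :=
  (memLp_of_continuous (continuous_eigenFun x δ μ k) 2).toLp

theorem isContRep_eigenVec (x : EuclideanSpace ℝ (Fin 2)) (δ μ k : ℝ) :
    IsContRep (eigenVec x δ μ k) (eigenFun x δ μ k) :=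
  ⟨(continuous_eigenFun x δ μ k).continuousOn, MemLp.coeFn_toLp _⟩

theorem vMinus_ne_zero (x : EuclideanSpace ℝ (Fin 2)) : vMinus x ≠ 0 := fun h => by
  simpa [vMinus] using congrArg (fun v : C2 => v 0) h

theorem eigenVec_ne_zero (x : EuclideanSpace ℝ (Fin 2)) (δ μ k : ℝ) : eigenVec x δ μ k ≠ 0 := by
  intro hzero
  have hrep := isContRep_eigenVec x δ μ k
  rw [hzero] at hrep
  have hEq := hrep.eqOn ⟨continuousOn_const, Lp.coeFn_zero _ _ _⟩ (Set.left_mem_Icc.2 (by norm_num))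
  exact vMinus_ne_zero x ((eigenFun_neg_one x δ μ k).symm.trans hEq)

theorem hasWeakDeriv_eigenVec (hx : ‖x‖ = 1) {δ μ k : ℝ} (hk : k ≠ 0)
    (hkμ : k ^ 2 = μ ^ 2 - δ ^ 2) :
    HasWeakDeriv (eigenVec x δ μ k) (matMul (genMat x δ μ) (eigenVec x δ μ k)) := by
  refine hasWeakDeriv_iff_exists_ae_eq.2 ⟨eigenFun x δ μ k (-1), ?_⟩
  have hrep := isContRep_eigenVec x δ μ k
  filter_upwards [hrep.2, ae_restrict_mem measurableSet_Ioo] with t ht hmem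
  have hprim := primitive_vol_eq_sub_of_hasDerivAt (hasDerivAt_eigenFun hx hk hkμ)
    ((matCLM _).continuous.comp (continuous_eigenFun x δ μ k)) (Set.Ioo_subset_Icc_self hmem)
  have hcongr := integral_congr_ae
    (ae_restrict_of_ae (s := Set.Iic t) (hrep.matMul (genMat x δ μ)).2)
  rw [ht, primitive, hcongr]
  exact (add_sub_cancel _ _).symm.trans (congrArg _ hprim.symm)

theorem eigenVec_mem_eigenspace (hx : ‖x‖ = 1) {δ μ k : ℝ} (hk : k ≠ 0)
    (hkμ : k ^ 2 = μ ^ 2 - δ ^ 2) (hsec : Real.cos (2 * k) + δ / k * Real.sin (2 * k) = 0) :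
    eigenVec x δ μ k ∈ eigenspace (transverseOp x δ) (μ : ℂ) := by
  have hderiv := hasWeakDeriv_eigenVec hx hk hkμ
  have hbc : BoundaryCond x (eigenFun x δ μ k) := by
    rw [boundaryCond_iff hx, swapMat_eigenFun_one hx, hsec, eigenFun_neg_one, swapMat_vMinus hx]
    simp
  exact (mem_eigenspace_iff hx δ μ _).2
    ⟨⟨⟨_, hderiv⟩, _, isContRep_eigenVec x δ μ k, hbc⟩, hderiv⟩

theorem exists_smul_eigenVec (hx : ‖x‖ = 1) {δ μ k : ℝ} (hk : k ≠ 0)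
    (hkμ : k ^ 2 = μ ^ 2 - δ ^ 2) {f : L2} (hf : f ∈ eigenspace (transverseOp x δ) (μ : ℂ)) :
    ∃ c : ℂ, f = c • eigenVec x δ μ k ∧
      c * ((Real.cos (2 * k) + δ / k * Real.sin (2 * k) : ℝ) : ℂ) = 0 := by
  obtain ⟨hdom, hderiv⟩ := (mem_eigenspace_iff hx δ μ f).1 hf
  obtain ⟨u, hu⟩ := hderiv.exists_isContRep
  have hbc := boundaryCond_of_mem hdom hu
  set c : ℂ := u (-1) 0 with hc
  have hstart : u (-1) = c • vMinus x := by
    ext i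
    fin_cases i
    · simp [vMinus, hc]
    · simpa [vMinus, hc, mul_comm] using hbc.2
  have hEq : Set.EqOn u (fun t => c • eigenFun x δ μ k t) (Set.Icc (-1) 1) := by
    refine hderiv.eqOn_of_linear_ode hu (fun t => ?_) (by rw [eigenFun_neg_one, hstart])
    rw [map_smul]
    exact (hasDerivAt_eigenFun hx hk hkμ t).const_smul c
  refine ⟨c, ?_, ?_⟩
  · refine Lp.ext ?_
    filter_upwards [hu.2, Lp.coeFn_smul c (eigenVec x δ μ k), (isContRep_eigenVec x δ μ k).2,
      ae_restrict_mem measurableSet_Ioo] with t hut hsmul het hmem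
    rw [hut, hEq (Set.Ioo_subset_Icc_self hmem), hsmul, Pi.smul_apply, het]
  · have hend := ((boundaryCond_iff hx).1 hbc).1
    rw [hEq (Set.right_mem_Icc.2 (by norm_num)), map_smul, swapMat_eigenFun_one hx, smul_sub,
      sub_eq_self, smul_smul, smul_smul] at hend
    linear_combination ((smul_eq_zero.1 hend).resolve_right (vMinus_ne_zero x)) / 2

theorem sq_waveNumber_eq (δ : ℝ) (j : ℕ) :
    waveNumber δ j ^ 2 = eigenvalueSeq δ j ^ 2 - δ ^ 2 := by
  rw [eigenvalueSeq_sq, add_sub_cancel_right]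

theorem eigenspace_eigenvalueSeq (hx : ‖x‖ = 1) {δ : ℝ} (hδ : 0 ≤ δ) {j : ℕ} (hj : 1 ≤ j) :
    eigenspace (transverseOp x δ) (eigenvalueSeq δ j : ℂ) =
      Submodule.span ℂ {eigenVec x δ (eigenvalueSeq δ j) (waveNumber δ j)} := by
  have hk := waveNumber_pos hδ hj
  refine le_antisymm (fun f hf => ?_) ((Submodule.span_singleton_le_iff_mem _ _).2 ?_)
  · obtain ⟨c, hc, -⟩ := exists_smul_eigenVec hx hk.ne' (sq_waveNumber_eq δ j) hf
    exact Submodule.mem_span_singleton.2 ⟨c, hc.symm⟩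
  · exact eigenVec_mem_eigenspace hx hk.ne' (sq_waveNumber_eq δ j)
      ((secular_iff_exists_waveNumber_eq hδ hk).2 ⟨j, hj, rfl⟩)

theorem exists_eigenvalueSeq_eq (hx : ‖x‖ = 1) {δ μ : ℝ} (hδ : 0 ≤ δ) (hμ : 0 < μ) {f : L2}
    (hf : f ∈ eigenspace (transverseOp x δ) (μ : ℂ)) (hf0 : f ≠ 0) :
    ∃ j, 1 ≤ j ∧ eigenvalueSeq δ j = μ := by
  have hpos : 0 < μ ^ 2 - δ ^ 2 := sub_pos.2 (sq_lt_sq_of_mem_eigenspace hx hδ hf hf0)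
  have hk : 0 < Real.sqrt (μ ^ 2 - δ ^ 2) := Real.sqrt_pos.2 hpos
  have hkμ : Real.sqrt (μ ^ 2 - δ ^ 2) ^ 2 = μ ^ 2 - δ ^ 2 := Real.sq_sqrt hpos.le
  obtain ⟨c, rfl, hsec⟩ := exists_smul_eigenVec hx hk.ne' hkμ hf
  have hsec' := Complex.ofReal_eq_zero.1 ((mul_eq_zero.1 hsec).resolve_left
    (left_ne_zero_of_smul hf0))
  obtain ⟨j, hj, hjk⟩ := (secular_iff_exists_waveNumber_eq hδ hk).1 hsec'
  exact ⟨j, hj, (eigenvalueSeq_eq_iff hδ hμ hk hkμ hj).2 hjk⟩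

theorem isPosEigenvalueSeq (hx : ‖x‖ = 1) {δ : ℝ} (hδ : 0 ≤ δ) :
    IsPosEigenvalueSeq (transverseOp x δ) (eigenvalueSeq δ) := by
  have hmono := strictMonoOn_eigenvalueSeq hδ
  refine ⟨hmono.monotoneOn, fun j hj => eigenvalueSeq_pos hδ hj, fun μ hμ => ?_⟩
  by_cases hex : ∃ j, 1 ≤ j ∧ eigenvalueSeq δ j = μ
  · obtain ⟨j, hj, rfl⟩ := hex
    have hcard : Cardinal.mk {i : ℕ // 1 ≤ i ∧ eigenvalueSeq δ i = eigenvalueSeq δ j} = 1 := by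
      rw [Cardinal.eq_one_iff_unique]
      exact ⟨⟨fun a b => Subtype.ext (hmono.injOn a.2.1 b.2.1 (a.2.2.trans b.2.2.symm))⟩,
        ⟨⟨j, hj, rfl⟩⟩⟩
    rw [hcard, eigenspace_eigenvalueSeq hx hδ hj,
      ← (LinearEquiv.toSpanNonzeroSingleton ℂ L2 _ (eigenVec_ne_zero x δ _ _)).rank_eq,
      Module.rank_self]
  · have hbot : eigenspace (transverseOp x δ) (μ : ℂ) = ⊥ := by
      rw [Submodule.eq_bot_iff]
      intro f hf
      by_contra hf0
      exact hex (exists_eigenvalueSeq_eq hx hδ hμ hf hf0)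
    have hempty : IsEmpty {i : ℕ // 1 ≤ i ∧ eigenvalueSeq δ i = μ} := ⟨fun a => hex ⟨a.1, a.2⟩⟩
    rw [hbot, rank_bot, Cardinal.mk_eq_zero]

end

/-! ### Charge conjugation -/

theorem chargeConjC2_apply_zero (v : C2) : chargeConjC2 v 0 = starRingEnd ℂ (v 1) := by
  change matCLM pauli1 (conjC2 v) 0 = _
  rw [matCLM_apply_zero]
  simp [pauli1, conjC2]

theorem chargeConjC2_apply_one (v : C2) : chargeConjC2 v 1 = starRingEnd ℂ (v 0) := by
  change matCLM pauli1 (conjC2 v) 1 = _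
  rw [matCLM_apply_one]
  simp [pauli1, conjC2]

theorem chargeConjC2_chargeConjC2 (v : C2) : chargeConjC2 (chargeConjC2 v) = v := by
  ext i
  fin_cases i <;> simp [chargeConjC2_apply_zero, chargeConjC2_apply_one]

theorem norm_chargeConjC2 (v : C2) : ‖chargeConjC2 v‖ = ‖v‖ := by
  rw [EuclideanSpace.norm_eq, EuclideanSpace.norm_eq, Fin.sum_univ_two, Fin.sum_univ_two,
    chargeConjC2_apply_zero, chargeConjC2_apply_one, RCLike.norm_conj, RCLike.norm_conj, add_comm]

theorem coeFn_chargeConj (f : L2) : chargeConj f =ᵐ[vol] fun t => chargeConjC2 (f t) :=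
  ContinuousLinearMap.coeFn_compLpL _ _

theorem chargeConj_chargeConj (f : L2) : chargeConj (chargeConj f) = f := by
  refine Lp.ext ?_
  filter_upwards [coeFn_chargeConj (chargeConj f), coeFn_chargeConj f] with t hCC hC
  rw [hCC, hC, chargeConjC2_chargeConjC2]

theorem norm_chargeConj (f : L2) : ‖chargeConj f‖ = ‖f‖ := by
  rw [Lp.norm_def, Lp.norm_def]
  refine congrArg ENNReal.toReal (eLpNorm_congr_norm_ae ?_)
  filter_upwards [coeFn_chargeConj f] with t ht
  rw [ht, norm_chargeConjC2]

theorem supDist_chargeConj (f : L2) (g : ℝ → C2) :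
    supDist (chargeConj f) (fun t => chargeConjC2 (g t)) = supDist f g := by
  refine eLpNorm_congr_norm_ae ?_
  filter_upwards [coeFn_chargeConj f] with t ht
  rw [ht, ← map_sub, norm_chargeConjC2]

theorem IsContRep.chargeConj {f : L2} {u : ℝ → C2} (hu : IsContRep f u) :
    IsContRep (chargeConj f) (fun t => chargeConjC2 (u t)) := by
  refine ⟨chargeConjC2.continuous.comp_continuousOn hu.1, ?_⟩
  filter_upwards [coeFn_chargeConj f, hu.2] with t hC hut
  rw [hC, hut]

theorem chargeConjC2_swapMat (x : EuclideanSpace ℝ (Fin 2)) (v : C2) :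
    chargeConjC2 (matCLM (swapMat x) v) = matCLM (swapMat x) (chargeConjC2 v) := by
  ext i
  fin_cases i <;> simp [chargeConjC2_apply_zero, chargeConjC2_apply_one, matCLM_apply_zero,
    matCLM_apply_one, swapMat]

theorem chargeConjC2_pauliDot (x : EuclideanSpace ℝ (Fin 2)) (v : C2) :
    chargeConjC2 (matCLM (pauliDot x) v) = matCLM (pauliDot x) (chargeConjC2 v) := by
  ext i
  fin_cases i <;> simp [chargeConjC2_apply_zero, chargeConjC2_apply_one, matCLM_apply_zero,
    matCLM_apply_one, pauliDot_eq]

theorem chargeConjC2_genMat (x : EuclideanSpace ℝ (Fin 2)) (δ : ℝ) (z : ℂ) (v : C2) :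
    chargeConjC2 (matCLM (genMat x δ z) v) =
      matCLM (genMat x δ (-starRingEnd ℂ z)) (chargeConjC2 v) := by
  simp only [genMat, matCLM, map_sub, map_smul, sub_apply, smul_apply, map_smulₛₗ,
    chargeConjC2_swapMat, chargeConjC2_pauliDot, map_mul, Complex.conj_I, Complex.conj_ofReal,
    neg_mul, mul_neg]

theorem HasWeakDeriv.chargeConj {x : EuclideanSpace ℝ (Fin 2)} {δ : ℝ} {z : ℂ} {f : L2}
    (hf : HasWeakDeriv f (TransverseDirac.matMul (genMat x δ z) f)) :
    HasWeakDeriv (chargeConj f)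
      (TransverseDirac.matMul (genMat x δ (-starRingEnd ℂ z)) (TransverseDirac.chargeConj f)) := by
  refine hf.comp_realCLM ((AddMonoidHomClass.toAddMonoidHom chargeConjC2).toRealLinearMap
    chargeConjC2.continuous) (coeFn_chargeConj f) ?_
  filter_upwards [coeFn_matMul (genMat x δ (-starRingEnd ℂ z)) (TransverseDirac.chargeConj f),
    coeFn_chargeConj f, coeFn_matMul (genMat x δ z) f] with t hMC hC hM
  rw [hMC, hC, hM]
  exact (chargeConjC2_genMat x δ z (f t)).symm

theorem IsNormalizedEigenvector.chargeConj {x : EuclideanSpace ℝ (Fin 2)} (hx : ‖x‖ = 1) {δ : ℝ}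
    {z : ℂ} {f : L2} (hf : IsNormalizedEigenvector (transverseOp x δ) z f) :
    IsNormalizedEigenvector (transverseOp x δ) (-starRingEnd ℂ z) (chargeConj f) := by
  refine ⟨?_, (norm_chargeConj f).trans hf.2⟩
  obtain ⟨hdom, hderiv⟩ := (mem_eigenspace_iff hx δ z f).1 hf.1
  obtain ⟨u, hu⟩ := hderiv.exists_isContRep
  obtain ⟨hplus, hminus⟩ := (boundaryCond_iff hx).1 (boundaryCond_of_mem hdom hu)
  refine (mem_eigenspace_iff hx δ _ _).2 ⟨⟨⟨_, hderiv.chargeConj⟩, _, hu.chargeConj,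
    (boundaryCond_iff hx).2 ⟨?_, ?_⟩⟩, hderiv.chargeConj⟩
  · rw [← chargeConjC2_swapMat, hplus]
  · rw [← chargeConjC2_swapMat, hminus, map_neg]

/-! ### Convergence of the eigenfunctions -/

theorem waveNumber_le_eigenvalueSeq (δ : ℝ) (j : ℕ) : waveNumber δ j ≤ eigenvalueSeq δ j :=
  Real.le_sqrt_of_sq_le (le_add_of_nonneg_right (sq_nonneg δ))

theorem eigenvalueSeq_le_add {δ : ℝ} (hδ : 0 ≤ δ) {j : ℕ} (hj : 1 ≤ j) :
    eigenvalueSeq δ j ≤ waveNumber δ j + δ := by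
  have hk := waveNumber_pos hδ hj
  refine Real.sqrt_le_iff.2 ⟨by positivity, ?_⟩
  nlinarith [mul_nonneg hk.le hδ]

theorem norm_eq_sqrt_two_mul_of_ae_norm_eq {f : L2} {r : ℝ} (hr : 0 ≤ r)
    (h : ∀ᵐ t ∂vol, ‖f t‖ = r) : ‖f‖ = √2 * r := by
  have hnorm : eLpNorm f 2 vol = eLpNorm (fun _ : ℝ => r) 2 vol := by
    refine eLpNorm_congr_norm_ae (h.mono fun t ht => ?_)
    rw [ht, Real.norm_of_nonneg hr]
  rw [Lp.norm_def, hnorm, eLpNorm_const' _ (by norm_num) (by norm_num),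
    Measure.restrict_apply_univ, Real.volume_Ioo, ENNReal.toReal_mul, ← ENNReal.toReal_rpow,
    ENNReal.toReal_ofReal (by norm_num), toReal_enorm, Real.norm_of_nonneg hr, Real.sqrt_eq_rpow]
  norm_num [mul_comm]

theorem norm_le_sqrt_two_mul_of_ae_norm_le {f : L2} {C : ℝ} (hC : 0 ≤ C)
    (h : ∀ᵐ t ∂vol, ‖f t‖ ≤ C) : ‖f‖ ≤ √2 * C := by
  have hbound := Lp.norm_le_of_ae_bound hC h
  rw [measureUnivNNReal, Measure.restrict_apply_univ, Real.volume_Ioo] at hbound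
  rw [Real.sqrt_eq_rpow]
  norm_num at hbound ⊢
  exact hbound

section

variable {x : EuclideanSpace ℝ (Fin 2)}

theorem norm_toC (hx : ‖x‖ = 1) : ‖toC x‖ = 1 := by
  have hsq := congrArg norm (toC_mul_conj hx)
  rw [norm_mul, RCLike.norm_conj, norm_one] at hsq
  nlinarith [norm_nonneg (toC x)]

theorem norm_sq_smul_vMinus_add_smul_vPlus (hx : ‖x‖ = 1) (a b : ℝ) :
    ‖(a : ℂ) • vMinus x + (b : ℂ) • vPlus x‖ ^ 2 = 2 * (a ^ 2 + b ^ 2) := by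
  have hfst : ((a : ℂ) • vMinus x + (b : ℂ) • vPlus x) 0 = ((a + b : ℝ) : ℂ) := by
    simp [vMinus, vPlus]
  have hsnd : ((a : ℂ) • vMinus x + (b : ℂ) • vPlus x) 1 =
      ((b - a : ℝ) : ℂ) * (Complex.I * toC x) := by
    simp only [vMinus, vPlus, PiLp.add_apply, PiLp.smul_apply, smul_eq_mul]
    push_cast
    simp
    ring
  rw [EuclideanSpace.norm_sq_eq, Fin.sum_univ_two, hfst, hsnd, norm_mul, norm_mul,
    Complex.norm_I, norm_toC hx, Complex.norm_real, Complex.norm_real, Real.norm_eq_abs,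
    Real.norm_eq_abs, mul_one, mul_one, sq_abs, sq_abs]
  ring

theorem norm_smul_vMinus_add_smul_vPlus_le (hx : ‖x‖ = 1) (a b : ℝ) :
    ‖(a : ℂ) • vMinus x + (b : ℂ) • vPlus x‖ ≤ 2 * (|a| + |b|) := by
  refine le_of_sq_le_sq ?_ (by positivity)
  rw [norm_sq_smul_vMinus_add_smul_vPlus hx, ← sq_abs a, ← sq_abs b]
  nlinarith [mul_nonneg (abs_nonneg a) (abs_nonneg b)]

theorem profilePlus_eq (x : EuclideanSpace ℝ (Fin 2)) {j : ℕ} (hj : 1 ≤ j) (t : ℝ) :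
    profilePlus x j t = (1 / 2 : ℂ) • eigenFun x 0 (freeWaveNumber j) (freeWaveNumber j) t := by
  rw [eigenFun, div_self (freeWaveNumber_pos hj).ne', zero_div, zero_mul, add_zero, one_mul,
    smul_add, smul_smul, smul_smul, profilePlus, vMinus, vPlus, freeWaveNumber]
  push_cast
  rfl

theorem eigenFun_sub_eigenFun (x : EuclideanSpace ℝ (Fin 2)) (δ μ k : ℝ) {c : ℝ} (hc : c ≠ 0)
    (t : ℝ) : eigenFun x δ μ k t - eigenFun x 0 c c t =
      ((Real.cos (k * (t + 1)) - Real.cos (c * (t + 1)) +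
        δ / k * Real.sin (k * (t + 1)) : ℝ) : ℂ) • vMinus x +
      ((Real.sin (k * (t + 1)) - Real.sin (c * (t + 1)) +
        (μ / k - 1) * Real.sin (k * (t + 1)) : ℝ) : ℂ) • vPlus x := by
  rw [eigenFun, eigenFun, div_self hc]
  push_cast
  module

theorem norm_eigenFun_sub_le (hx : ‖x‖ = 1) {δ μ k c : ℝ} (hk : 1 / 2 ≤ k) (hc : c ≠ 0)
    (hδ : 0 ≤ δ) (hkc : |k - c| ≤ δ) (hμk : |μ - k| ≤ δ) {t : ℝ} (ht : t ∈ Set.Icc (-1 : ℝ) 1) :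
    ‖eigenFun x δ μ k t - eigenFun x 0 c c t‖ ≤ 16 * δ := by
  have hkpos : 0 < k := by linarith
  have hphase : |k * (t + 1) - c * (t + 1)| ≤ 2 * δ := by
    rw [← sub_mul, abs_mul, mul_comm, abs_of_nonneg (by linarith [ht.1] : 0 ≤ t + 1)]
    exact mul_le_mul (by linarith [ht.2]) hkc (abs_nonneg _) (by norm_num)
  have hcos : |Real.cos (k * (t + 1)) - Real.cos (c * (t + 1))| ≤ 2 * δ :=
    (Real.abs_cos_sub_cos_le _ _).trans hphase
  have hsin : |Real.sin (k * (t + 1)) - Real.sin (c * (t + 1))| ≤ 2 * δ :=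
    (Real.abs_sin_sub_sin_le _ _).trans hphase
  have hcoeff {a : ℝ} (ha : |a| ≤ δ) : |a / k * Real.sin (k * (t + 1))| ≤ 2 * δ := by
    rw [abs_mul, abs_div, abs_of_pos hkpos]
    refine (mul_le_of_le_one_right (by positivity) (Real.abs_sin_le_one _)).trans ?_
    rw [div_le_iff₀ hkpos]
    nlinarith
  have hμk' : μ / k - 1 = (μ - k) / k := by rw [sub_div, div_self hkpos.ne']
  rw [eigenFun_sub_eigenFun x δ μ k hc, hμk']
  refine (norm_smul_vMinus_add_smul_vPlus_le hx _ _).trans ?_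
  linarith [(abs_add_le _ _).trans (add_le_add hcos (hcoeff (abs_of_nonneg hδ).le)),
    (abs_add_le _ _).trans (add_le_add hsin (hcoeff hμk))]

theorem norm_eigenFun_zero (hx : ‖x‖ = 1) {c : ℝ} (hc : c ≠ 0) (t : ℝ) :
    ‖eigenFun x 0 c c t‖ = √2 := by
  rw [← sq_eq_sq₀ (norm_nonneg _) (Real.sqrt_nonneg _), Real.sq_sqrt (by norm_num), eigenFun,
    norm_sq_smul_vMinus_add_smul_vPlus hx, div_self hc, zero_div, zero_mul, add_zero, one_mul,
    Real.cos_sq_add_sin_sq, mul_one]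

theorem norm_eigenVec_zero (hx : ‖x‖ = 1) {c : ℝ} (hc : c ≠ 0) : ‖eigenVec x 0 c c‖ = 2 := by
  rw [norm_eq_sqrt_two_mul_of_ae_norm_eq (Real.sqrt_nonneg 2), Real.mul_self_sqrt zero_le_two]
  filter_upwards [(isContRep_eigenVec x 0 c c).2] with t ht
  rw [ht, norm_eigenFun_zero hx hc]

theorem norm_eigenFun_waveNumber_sub_le (hx : ‖x‖ = 1) {δ : ℝ} (hδ : 0 ≤ δ) {j : ℕ} (hj : 1 ≤ j)
    {t : ℝ} (ht : t ∈ Set.Icc (-1 : ℝ) 1) :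
    ‖eigenFun x δ (eigenvalueSeq δ j) (waveNumber δ j) t -
      eigenFun x 0 (freeWaveNumber j) (freeWaveNumber j) t‖ ≤ 16 * δ := by
  have hk := freeWaveNumber_le_waveNumber hδ hj
  refine norm_eigenFun_sub_le hx ((half_lt_freeWaveNumber hj).le.trans hk)
    (freeWaveNumber_pos hj).ne' hδ ?_ ?_ ht
  · rw [abs_of_nonneg (sub_nonneg.2 hk)]
    exact waveNumber_sub_freeWaveNumber_le hδ hj
  · rw [abs_of_nonneg (sub_nonneg.2 (waveNumber_le_eigenvalueSeq δ j))]
    exact sub_le_iff_le_add'.2 (eigenvalueSeq_le_add hδ hj)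

theorem abs_norm_eigenVec_sub_two_le (hx : ‖x‖ = 1) {δ : ℝ} (hδ : 0 ≤ δ) {j : ℕ} (hj : 1 ≤ j) :
    |‖eigenVec x δ (eigenvalueSeq δ j) (waveNumber δ j)‖ - 2| ≤ 32 * δ := by
  set f := eigenVec x δ (eigenvalueSeq δ j) (waveNumber δ j)
  set g := eigenVec x 0 (freeWaveNumber j) (freeWaveNumber j)
  have hbound : ∀ᵐ t ∂vol, ‖(f - g : L2) t‖ ≤ 16 * δ := by
    filter_upwards [Lp.coeFn_sub f g, (isContRep_eigenVec x δ _ _).2,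
      (isContRep_eigenVec x 0 _ _).2,
      ae_restrict_mem measurableSet_Ioo] with t hsub hf hg ht
    rw [hsub, Pi.sub_apply, hf, hg]
    exact norm_eigenFun_waveNumber_sub_le hx hδ hj (Set.Ioo_subset_Icc_self ht)
  have hsqrt : √2 ≤ 2 := Real.sqrt_le_iff.2 (by norm_num)
  calc |‖f‖ - 2| = |‖f‖ - ‖g‖| := by rw [norm_eigenVec_zero hx (freeWaveNumber_pos hj).ne']
    _ ≤ ‖f - g‖ := abs_norm_sub_norm_le f g
    _ ≤ √2 * (16 * δ) := norm_le_sqrt_two_mul_of_ae_norm_le (by positivity) hbound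
    _ ≤ 2 * (16 * δ) := by gcongr
    _ = 32 * δ := by ring

/-- The normalized eigenfunction for the `j`-th positive eigenvalue. -/
def normEigenVec (x : EuclideanSpace ℝ (Fin 2)) (δ : ℝ) (j : ℕ) : L2 :=
  ((‖eigenVec x δ (eigenvalueSeq δ j) (waveNumber δ j)‖⁻¹ : ℝ) : ℂ) •
    eigenVec x δ (eigenvalueSeq δ j) (waveNumber δ j)

theorem norm_normEigenVec (x : EuclideanSpace ℝ (Fin 2)) (δ : ℝ) (j : ℕ) :
    ‖normEigenVec x δ j‖ = 1 := by
  rw [normEigenVec, norm_smul, Complex.norm_real, norm_inv, norm_norm,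
    inv_mul_cancel₀ (norm_ne_zero_iff.2 (eigenVec_ne_zero x δ _ _))]

theorem eigenspace_eigenvalueSeq_eq_span_normEigenVec (hx : ‖x‖ = 1) {δ : ℝ} (hδ : 0 ≤ δ) {j : ℕ}
    (hj : 1 ≤ j) :
    eigenspace (transverseOp x δ) (eigenvalueSeq δ j : ℂ) = ℂ ∙ normEigenVec x δ j := by
  have hunit : ‖eigenVec x δ (eigenvalueSeq δ j) (waveNumber δ j)‖⁻¹ ≠ 0 :=
    inv_ne_zero (norm_ne_zero_iff.2 (eigenVec_ne_zero x δ _ _))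
  rw [eigenspace_eigenvalueSeq hx hδ hj, normEigenVec,
    Submodule.span_singleton_smul_eq (Complex.ofReal_ne_zero.2 hunit).isUnit]

theorem isNormalizedEigenvector_normEigenVec (hx : ‖x‖ = 1) {δ : ℝ} (hδ : 0 ≤ δ) {j : ℕ}
    (hj : 1 ≤ j) :
    IsNormalizedEigenvector (transverseOp x δ) (eigenvalueSeq δ j : ℂ) (normEigenVec x δ j) :=
  ⟨eigenspace_eigenvalueSeq_eq_span_normEigenVec hx hδ hj ▸ Submodule.mem_span_singleton_self _,
    norm_normEigenVec x δ j⟩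

theorem exists_smul_eq_normEigenVec (hx : ‖x‖ = 1) {δ : ℝ} (hδ : 0 ≤ δ) {j : ℕ} (hj : 1 ≤ j)
    {ψ : L2} (hψ : IsNormalizedEigenvector (transverseOp x δ) (eigenvalueSeq δ j : ℂ) ψ) :
    ∃ c : ℂ, ‖c‖ = 1 ∧ c • ψ = normEigenVec x δ j := by
  obtain ⟨hmem, hnorm⟩ := hψ
  rw [eigenspace_eigenvalueSeq_eq_span_normEigenVec hx hδ hj] at hmem
  obtain ⟨a, rfl⟩ := Submodule.mem_span_singleton.1 hmem
  rw [norm_smul, norm_normEigenVec, mul_one] at hnorm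
  exact ⟨a⁻¹, by rw [norm_inv, hnorm, inv_one],
    inv_smul_smul₀ (norm_ne_zero_iff.1 (hnorm ▸ one_ne_zero)) _⟩

theorem exists_smul_eq_chargeConj_normEigenVec (hx : ‖x‖ = 1) {δ : ℝ} (hδ : 0 ≤ δ) {j : ℕ}
    (hj : 1 ≤ j) {ψ : L2}
    (hψ : IsNormalizedEigenvector (transverseOp x δ) (-(eigenvalueSeq δ j : ℂ)) ψ) :
    ∃ c : ℂ, ‖c‖ = 1 ∧ c • ψ = chargeConj (normEigenVec x δ j) := by
  obtain ⟨c, hc, hcψ⟩ := exists_smul_eq_normEigenVec hx hδ hj (ψ := chargeConj ψ)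
    (by simpa using hψ.chargeConj hx)
  refine ⟨starRingEnd ℂ c, by rw [RCLike.norm_conj, hc], ?_⟩
  rw [← hcψ, map_smulₛₗ, chargeConj_chargeConj]

theorem normEigenVec_sub_profilePlus_ae_eq (x : EuclideanSpace ℝ (Fin 2)) (δ : ℝ) {j : ℕ}
    (hj : 1 ≤ j) {N : ℝ} (hN : ‖eigenVec x δ (eigenvalueSeq δ j) (waveNumber δ j)‖ = N) :
    ∀ᵐ t ∂vol, normEigenVec x δ j t - profilePlus x j t =
      ((N⁻¹ : ℝ) : ℂ) • (eigenFun x δ (eigenvalueSeq δ j) (waveNumber δ j) t -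
        eigenFun x 0 (freeWaveNumber j) (freeWaveNumber j) t) +
      ((N⁻¹ - 1 / 2 : ℝ) : ℂ) • eigenFun x 0 (freeWaveNumber j) (freeWaveNumber j) t := by
  filter_upwards [(isContRep_eigenVec x δ _ _).2, Lp.coeFn_smul ((N⁻¹ : ℝ) : ℂ)
    (eigenVec x δ (eigenvalueSeq δ j) (waveNumber δ j))] with t hf hsmul
  rw [normEigenVec, hN, hsmul, Pi.smul_apply, hf, profilePlus_eq x hj]
  push_cast
  module

theorem supDist_normEigenVec_le (hx : ‖x‖ = 1) {δ : ℝ} (hδ : 0 ≤ δ) (hδ' : δ ≤ 1 / 32) {j : ℕ}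
    (hj : 1 ≤ j) :
    supDist (normEigenVec x δ j) (profilePlus x j) ≤ ENNReal.ofReal (48 * δ) := by
  obtain ⟨N, hN⟩ : ∃ N, ‖eigenVec x δ (eigenvalueSeq δ j) (waveNumber δ j)‖ = N := ⟨_, rfl⟩
  have hN2 : |N - 2| ≤ 32 * δ := hN ▸ abs_norm_eigenVec_sub_two_le hx hδ hj
  have hN1 : 1 ≤ N := by linarith [(abs_le.1 hN2).1]
  have hinv : N⁻¹ ≤ 1 := inv_le_one_of_one_le₀ hN1
  have hinv_sub : |N⁻¹ - 1 / 2| ≤ 16 * δ := by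
    have hfactor : N⁻¹ - 1 / 2 = -(N - 2) * (N⁻¹ / 2) := by
      field_simp
      ring
    rw [hfactor, abs_mul, abs_neg, abs_of_nonneg (by positivity : 0 ≤ N⁻¹ / 2)]
    nlinarith [abs_nonneg (N - 2)]
  have hsqrt : √2 ≤ 2 := Real.sqrt_le_iff.2 (by norm_num)
  rw [supDist, eLpNorm_exponent_top]
  refine eLpNormEssSup_le_of_ae_bound ?_
  filter_upwards [normEigenVec_sub_profilePlus_ae_eq x δ hj hN,
    ae_restrict_mem measurableSet_Ioo] with t hsplit ht
  have hconv := norm_eigenFun_waveNumber_sub_le hx hδ hj (Set.Ioo_subset_Icc_self ht)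
  rw [hsplit]
  refine (norm_add_le _ _).trans ?_
  rw [norm_smul, norm_smul, Complex.norm_real, Complex.norm_real, Real.norm_eq_abs,
    Real.norm_eq_abs, norm_eigenFun_zero hx (freeWaveNumber_pos hj).ne',
    abs_of_nonneg (by positivity : 0 ≤ N⁻¹)]
  calc _ ≤ 1 * (16 * δ) + 16 * δ * 2 := by gcongr
    _ = 48 * δ := by ring

theorem supDist_chargeConj_normEigenVec_le (hx : ‖x‖ = 1) {δ : ℝ} (hδ : 0 ≤ δ)
    (hδ' : δ ≤ 1 / 32) {j : ℕ} (hj : 1 ≤ j) :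
    supDist (chargeConj (normEigenVec x δ j)) (profileMinus x j) ≤ ENNReal.ofReal (48 * δ) :=
  (supDist_chargeConj _ _).trans_le (supDist_normEigenVec_le hx hδ hδ' hj)

end

end

end TransverseDirac

theorem mainTheorem2 :
    ∃ lam : ℝ → ℕ → ℝ,
      -- (i)
      (∀ δ : ℝ, 0 ≤ δ → ∀ x : EuclideanSpace ℝ (Fin 2), ‖x‖ = 1 →
        IsSelfAdjoint (TransverseDirac.transverseOp x δ) ∧
        TransverseDirac.HasCompactResolvent (TransverseDirac.transverseOp x δ) ∧
        (∀ z : ℂ, z ∈ TransverseDirac.spectrum (TransverseDirac.transverseOp x δ) ↔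
          -z ∈ TransverseDirac.spectrum (TransverseDirac.transverseOp x δ)) ∧
        (∀ y : EuclideanSpace ℝ (Fin 2), ‖y‖ = 1 →
          TransverseDirac.spectrum (TransverseDirac.transverseOp x δ) =
            TransverseDirac.spectrum (TransverseDirac.transverseOp y δ)) ∧
        TransverseDirac.IsPosEigenvalueSeq (TransverseDirac.transverseOp x δ) (lam δ) ∧
        (∀ j : ℕ, 1 ≤ j →
          (2 * (j : ℝ) - 1) ^ 2 * (Real.pi ^ 2 / 16) ≤ lam δ j ^ 2 - δ ^ 2 ∧
          lam δ j ^ 2 - δ ^ 2 ≤ (j : ℝ) ^ 2 * (Real.pi ^ 2 / 4)) ∧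
        (∀ j : ℕ, 1 ≤ j → ∀ φ : TransverseDirac.L2,
          TransverseDirac.IsNormalizedEigenvector
            (TransverseDirac.transverseOp x δ) (lam δ j : ℂ) φ →
          TransverseDirac.IsNormalizedEigenvector
            (TransverseDirac.transverseOp x δ) (-(lam δ j : ℂ))
            (TransverseDirac.chargeConj φ))) ∧
      -- (ii)
      (∀ j : ℕ, 1 ≤ j →
        (fun δ : ℝ => lam δ j -
          ((2 * (j : ℝ) - 1) * Real.pi / 4 + 2 / ((2 * (j : ℝ) - 1) * Real.pi) * δ +
            (-16 / ((2 * (j : ℝ) - 1) ^ 3 * Real.pi ^ 3) +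
              2 / ((2 * (j : ℝ) - 1) * Real.pi)) * δ ^ 2))
          =O[nhdsWithin 0 (Set.Ici 0)] (fun δ : ℝ => δ ^ 3)) ∧
      -- (iii)
      (∀ j : ℕ, 1 ≤ j → ∃ C > (0 : ℝ), ∃ δ₀ > (0 : ℝ),
        ∀ δ : ℝ, 0 ≤ δ → δ ≤ δ₀ → ∀ x : EuclideanSpace ℝ (Fin 2), ‖x‖ = 1 →
          (∃ φ : TransverseDirac.L2,
            TransverseDirac.IsNormalizedEigenvector
              (TransverseDirac.transverseOp x δ) (lam δ j : ℂ) φ ∧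
            TransverseDirac.supDist φ (TransverseDirac.profilePlus x j) ≤
              ENNReal.ofReal (C * δ) ∧
            TransverseDirac.supDist (TransverseDirac.chargeConj φ)
              (TransverseDirac.profileMinus x j) ≤ ENNReal.ofReal (C * δ)) ∧
          (∀ ψ : TransverseDirac.L2,
            TransverseDirac.IsNormalizedEigenvector
              (TransverseDirac.transverseOp x δ) (lam δ j : ℂ) ψ →
            ∃ c : ℂ, ‖c‖ = 1 ∧
              TransverseDirac.supDist (c • ψ : TransverseDirac.L2)
                (TransverseDirac.profilePlus x j) ≤ ENNReal.ofReal (C * δ)) ∧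
          (∀ ψ : TransverseDirac.L2,
            TransverseDirac.IsNormalizedEigenvector
              (TransverseDirac.transverseOp x δ) (-(lam δ j : ℂ)) ψ →
            ∃ c : ℂ, ‖c‖ = 1 ∧
              TransverseDirac.supDist (c • ψ : TransverseDirac.L2)
                (TransverseDirac.profileMinus x j) ≤ ENNReal.ofReal (C * δ))) ∧
      -- (iv)
      (∀ δ : ℝ, 0 ≤ δ → ∀ x : EuclideanSpace ℝ (Fin 2), ‖x‖ = 1 →
        ∀ (f : (TransverseDirac.transverseOp x δ).domain) (u : ℝ → TransverseDirac.C2),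
          TransverseDirac.IsContRep (f : TransverseDirac.L2) u →
          ‖TransverseDirac.transverseOp x δ f‖ ^ 2 =
            ‖TransverseDirac.domDeriv x f‖ ^ 2 + δ ^ 2 * ‖(f : TransverseDirac.L2)‖ ^ 2 +
              δ * (‖u 1‖ ^ 2 + ‖u (-1)‖ ^ 2)) := by
  refine ⟨TransverseDirac.eigenvalueSeq, fun δ hδ x hx =>
      ⟨TransverseDirac.isSelfAdjoint_transverseOp hx hδ,
        TransverseDirac.hasCompactResolvent_transverseOp hx hδ,
        TransverseDirac.mem_spectrum_iff_neg_mem hx δ,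
        fun y hy => TransverseDirac.spectrum_eq hx hy δ,
        TransverseDirac.isPosEigenvalueSeq hx hδ,
        fun j hj => TransverseDirac.eigenvalueSeq_bounds hδ hj,
        fun j _ φ hφ => by simpa using hφ.chargeConj hx⟩,
    fun j hj => TransverseDirac.isBigO_eigenvalueSeq_sub hj, fun j hj => ?_,
    fun δ _ x hx f u hu => TransverseDirac.norm_sq_transverseOp hx δ f hu⟩
  refine ⟨48, by norm_num, 1 / 32, by norm_num, fun δ hδ hδ' x hx => ?_⟩
  have hplus := TransverseDirac.supDist_normEigenVec_le hx hδ hδ' hj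
  have hminus := TransverseDirac.supDist_chargeConj_normEigenVec_le hx hδ hδ' hj
  refine ⟨⟨_, TransverseDirac.isNormalizedEigenvector_normEigenVec hx hδ hj, hplus, hminus⟩,
    fun ψ hψ => ?_, fun ψ hψ => ?_⟩
  · obtain ⟨c, hc, hcψ⟩ := TransverseDirac.exists_smul_eq_normEigenVec hx hδ hj hψ
    exact ⟨c, hc, hcψ ▸ hplus⟩
  · obtain ⟨c, hc, hcψ⟩ := TransverseDirac.exists_smul_eq_chargeConj_normEigenVec hx hδ hj hψ
    exact ⟨c, hc, hcψ ▸ hminus⟩
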